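/- Let $M\ge 2$ and $b>1$. Consider a downlink with $M$ transmit antennas and $M$ single-antenna users, unit-variance noise and total transmit power (SNR) $P>0$. The channel vectors $\mathbf h_1,\dots,\mathbf h_M\in\mathbb C^M$ have i.i.d. unit-variance complex Gaussian entries. Each user $i$ has its own codebook of $2^B$ unit vectors, where $2^B$ is a positive integer; all the vectors of all the codebooks are independent, isotropic on the unit sphere of $\mathbb C^M$, and independent of the channels. User $i$ feeds back, with $B$ bits, the codebook vector $\hat{\mathbf h}_i$ that maximizes $|\mathbf h_i^\dagger\mathbf w|$. Finite-rate feedback zero-forcing uses as beamforming vectors $\mathbf v_1,\dots,\mathbf v_M$ the normalized columns of the inverse of the matrix with rows $\hat{\mathbf h}_i^\dagger$, and power $P/M$ per stream, so that user $i$ has average rate $$R_i=\mathbb E\log_2\Bigl(1+\frac{\frac PM|\mathbf h_i^\dagger\mathbf v_i|^2}{1+\sum_{j\ne i}\frac PM|\mathbf h_i^\dagger\mathbf v_j|^2}\Bigr),$$ and throughput $R_{FB}(P)=\sum_i R_i$. Perfect-CSIT zero-forcing uses the normalized columns $\mathbf v_{ZF,i}$ of the inverse of the matrix with rows $\mathbf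 h_i^\dagger$, giving user $i$ the rate $R_{ZF,i}=\mathbb E\log_2\bigl(1+\frac PM|\mathbf h_i^\dagger\mathbf v_{ZF,i}|^2\bigr)$ and throughput $R_{ZF}(P)=\sum_i R_{ZF,i}$. Write $P_{dB}=10\log_{10}P$. (1) For every $P>0$, if the number of feedback bits per mobile is $$B=(M-1)\log_2P-(M-1)\log_2(b-1),$$ or larger (for instance this number rounded up to a nonnegative integer), then all these average rates are finite, $R_{ZF,i}-R_i<\log_2 b$ for every user $i$, and hence $\frac1M\bigl(R_{ZF}(P)-R_{FB}(P)\bigr)<\log_2 b$. (2) If $B=B(P)$ is scaled in this way for all large $P$, then the full multiplexing gain is achieved, $\lim_{P\to\infty}R_{FB}(P)/\log_2P=M$, and the high-SNR power offset from perfect-CSIT zero-forcing is at most $10\log_{10}b$ dB: for every $\delta>10\log_{10}b$ one has $R_{FB}(10^{\delta/10}P)\ge R_{ZF}(P)$ for all sufficiently large $P$. Here a throughput loss of $M\log_2b$ corresponds to a power factor $b$ in the sense that $R_{ZF}(P)-R_{ZF}(P/b)\to M\log_2 b$ as $P\to\infty$, and for $b=2$ the offset is $10\log_{10}2\approx 3$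 dB (within $1/80$). (3) In decibels, for every $P>0$, $(M-1)\log_2P-(M-1)\log_2(b-1)=(M-1)\frac{\log_2 10}{10}P_{dB}-(M-1)\log_2(b-1)$, where $\bigl|\frac{\log_2 10}{10}-\frac13\bigr|<\frac1{800}$, so that the number of bits is about $\frac{M-1}3P_{dB}-(M-1)\log_2(b-1)$. -/

import Mathlib

open MeasureTheory ProbabilityTheory Filter Topology

noncomputable section

namespace ZFFeedback

/-- Complex column vectors with `M` entries and the Euclidean norm.
`inner ℂ h v` is the product of the conjugate transpose of `h` with `v`. -/
abbrev CVec (M : ℕ) : Type := EuclideanSpace ℂ (Fin M)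

/-- The circularly symmetric complex Gaussian law of mean zero and unit variance: real and
imaginary parts are independent real Gaussians of variance `1/2`. -/
def complexGaussian : Measure ℂ :=
  ((gaussianReal 0 (1 / 2)).prod (gaussianReal 0 (1 / 2))).map
    (fun p : ℝ × ℝ => (⟨p.1, p.2⟩ : ℂ))

/-- The law of a vector whose `M` entries are iid unit variance complex Gaussians. -/
def gaussianVector (M : ℕ) : Measure (CVec M) :=
  (Measure.pi (fun _ : Fin M => complexGaussian)).map (WithLp.toLp 2)

/-- The normalization `u / ‖u‖` of a vector (and `0` for the zero vector). -/
def unitDir {M : ℕ} (u : CVec M) : CVec M := ((‖u‖⁻¹ : ℝ) : ℂ) • u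

/-- The isotropic (uniform) law on the complex unit sphere, realized as the law of the direction
of an iid complex Gaussian vector. -/
def isotropic (M : ℕ) : Measure (CVec M) := (gaussianVector M).map unitDir

/-- Rayleigh fading: the channel vectors of the `M` users are independent, with iid unit variance
complex Gaussian entries. -/
def channelLaw (M : ℕ) : Measure (Fin M → CVec M) :=
  Measure.pi (fun _ : Fin M => gaussianVector M)

/-- Random vector quantization: each of the `M` users has its own codebook of `N` vectors; all
the vectors of all the codebooks are independent and isotropic. -/
def codebookLaw (M N : ℕ) : Measure (Fin M → Fin N → CVec M) :=
  Measure.pi (fun _ : Fin M => Measure.pi (fun _ : Fin N => isotropic M))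

/-- The joint law of the channels and of the codebooks, which are independent. -/
def systemLaw (M N : ℕ) : Measure ((Fin M → CVec M) × (Fin M → Fin N → CVec M)) :=
  (channelLaw M).prod (codebookLaw M N)

open Classical in
/-- The indices `j` that maximize `|h† w_j|` over the codebook `w`. -/
def bestIndices {M N : ℕ} (h : CVec M) (w : Fin N → CVec M) : Finset (Fin N) :=
  Finset.univ.filter (fun j => ∀ k, ‖inner ℂ h (w k)‖ ≤ ‖inner ℂ h (w j)‖)

open Classical in
/-- The quantization of `h`: the codebook vector that maximizes `|h† w_j|`, the one of smallest
index in case of a tie (and `0` for the empty codebook). -/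
def quantize {M N : ℕ} (h : CVec M) (w : Fin N → CVec M) : CVec M :=
  if hne : (bestIndices h w).Nonempty then w ((bestIndices h w).min' hne) else 0

/-- The square matrix whose `i`-th row is the conjugate transpose of the vector `g i`. -/
def rowMatrix {M : ℕ} (g : Fin M → CVec M) : Matrix (Fin M) (Fin M) ℂ :=
  Matrix.of (fun i k => star (g i k))

/-- The zero-forcing beamforming vectors for the (estimated) channels `g`: the normalized columns
of the inverse of the concatenated channel matrix. -/
def zfBeam {M : ℕ} (g : Fin M → CVec M) (i : Fin M) : CVec M :=
  unitDir (WithLp.toLp 2 (fun k => (rowMatrix g)⁻¹ k i))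

/-- The SINR of user `i` at total power `P` (power `P / M` per stream, unit noise), for the
channels `h` and the beamforming vectors `v`. -/
def sinr {M : ℕ} (P : ℝ) (h v : Fin M → CVec M) (i : Fin M) : ℝ :=
  (P / M * ‖inner ℂ (h i) (v i)‖ ^ 2) /
    (1 + ∑ j ∈ Finset.univ.erase i, P / M * ‖inner ℂ (h i) (v j)‖ ^ 2)

/-- The instantaneous rate (bits per channel use) of user `i` under zero-forcing based on
perfect channel knowledge: all the interference is eliminated. -/
def zfInstRate {M : ℕ} (P : ℝ) (i : Fin M) (h : Fin M → CVec M) : ℝ :=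
  Real.logb 2 (1 + P / M * ‖inner ℂ (h i) (zfBeam h i)‖ ^ 2)

/-- The instantaneous rate of user `i` under zero-forcing based on the fed back quantized
channels, as a function of all the channels and all the codebooks. -/
def fbInstRate {M N : ℕ} (P : ℝ) (i : Fin M)
    (ω : (Fin M → CVec M) × (Fin M → Fin N → CVec M)) : ℝ :=
  Real.logb 2 (1 + sinr P ω.1 (zfBeam (fun j => quantize (ω.1 j) (ω.2 j))) i)

/-- The long-term average rate of user `i` for zero-forcing with perfect CSIT. -/
def zfUserRate (M : ℕ) (P : ℝ) (i : Fin M) : ℝ :=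
  ∫ h, zfInstRate P i h ∂(channelLaw M)

/-- The long-term average rate of user `i` for zero-forcing with finite-rate feedback and
codebooks of `N` vectors, averaged over the fading and over the codebooks. -/
def fbUserRate (M N : ℕ) (P : ℝ) (i : Fin M) : ℝ :=
  ∫ ω, fbInstRate P i ω ∂(systemLaw M N)

/-- The system throughput of zero-forcing with perfect CSIT. -/
def zfThroughput (M : ℕ) (P : ℝ) : ℝ := ∑ i : Fin M, zfUserRate M P i

/-- The system throughput of zero-forcing with finite-rate feedback. -/
def fbThroughput (M N : ℕ) (P : ℝ) : ℝ := ∑ i : Fin M, fbUserRate M N P i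

/-- The rate gap per mobile. -/
def rateGap (M N : ℕ) (P : ℝ) : ℝ := 1 / (M : ℝ) * (zfThroughput M P - fbThroughput M N P)

/-- A power (ratio) in decibels. -/
def decibel (P : ℝ) : ℝ := 10 * Real.logb 10 P

/-- The number of feedback bits per mobile prescribed for the rate offset `log₂ b` at SNR `P`. -/
def feedbackBits (M : ℕ) (b P : ℝ) : ℝ :=
  ((M : ℝ) - 1) * Real.logb 2 P - ((M : ℝ) - 1) * Real.logb 2 (b - 1)

/-- The throughput curve `R` achieves the multiplexing gain `r`. -/
def HasMultiplexingGain (R : ℝ → ℝ) (r : ℝ) : Prop :=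
  Tendsto (fun P => R P / Real.logb 2 P) atTop (𝓝 r)

/-- At high SNR, the curve `R` is at most `δ` dB behind the curve `R₀`: with any power increase
of more than `δ` dB, `R` reaches the throughput of `R₀` at all sufficiently high SNR. -/
def PowerOffsetAtMost (R₀ R : ℝ → ℝ) (δ : ℝ) : Prop :=
  ∀ δ' : ℝ, δ < δ' → ∀ᶠ P in atTop, R₀ P ≤ R ((10 : ℝ) ^ (δ' / 10) * P)

end ZFFeedback

end

open ZFFeedback

noncomputable section

namespace ZFFeedback

/-! Write `S` for the signal power and `I` for the interference power at user `i` under quantized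
feedback. The feedback rate is the mean of log₂(1 + I + S) − log₂(1 + I). The proof rests on the
fact that S has the same law as the signal power with perfect CSIT (`map_signal`). Beam `i` depends
on the rows of the other users only; these are independent of `h_i`, and only their directions
matter, which are isotropic in both systems. Dropping I from the first logarithm and applying Jensen
to the second bounds the rate gap by log₂(1 + E I) (`zfUserRate_sub_fbUserRate_le`).

To bound E I, condition on the channel and codebook of user `i`. Beam `j` is orthogonal to the
quantized channel `q` of user `i`, and its law is invariant under the unitary maps that fix `q`. By
symmetry it therefore puts at most 1/(M − 1) of its power on each direction orthogonal to `q`, and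
its mean gain is at most ‖h‖² sin²θ / (M − 1), where θ is the angle between `h` and `q`
(`leakage_le`). An isotropic vector falls within sin²θ ≤ z of a fixed direction with probability
z^(M−1) (`isotropic_cap`), so the best of N vectors has mean sin²θ at most ∫₀¹ (1 − z^(M−1))^N dz,
which is at most (N + 1)^(−1/(M−1)) (`integral_one_sub_pow_le`). Since E‖h‖² = M, the M − 1
interferers of power P/M give E I ≤ P (N + 1)^(−1/(M−1)). The prescribed number of bits makes this
less than b − 1.

At high SNR the feedback throughput lies between the perfect-CSIT curve and that curve minus M log₂
b. Dominated convergence yields the slope of the perfect-CSIT curve and its increment under a power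
factor, hence the multiplexing gain and the power offset. -/

theorem measurable_complex_mk : Measurable (fun p : ℝ × ℝ => (⟨p.1, p.2⟩ : ℂ)) :=
  Complex.measurableEquivRealProd.symm.measurable

instance : IsProbabilityMeasure complexGaussian :=
  Measure.isProbabilityMeasure_map measurable_complex_mk.aemeasurable

instance (M : ℕ) : IsProbabilityMeasure (gaussianVector M) :=
  Measure.isProbabilityMeasure_map (by fun_prop)

theorem real_inner_eq_re {M : ℕ} (x y : CVec M) :
    inner ℝ x y = (inner ℂ x y).re := by
  simp [PiLp.inner_apply, Complex.inner]

theorem measurable_unitDir {M : ℕ} : Measurable (unitDir : CVec M → CVec M) := by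
  unfold unitDir; fun_prop

instance (M : ℕ) : IsProbabilityMeasure (isotropic M) :=
  Measure.isProbabilityMeasure_map measurable_unitDir.aemeasurable
instance (M : ℕ) : IsProbabilityMeasure (channelLaw M) := by unfold channelLaw; infer_instance
instance (M N : ℕ) : IsProbabilityMeasure (codebookLaw M N) := by unfold codebookLaw; infer_instance
instance (M N : ℕ) : IsProbabilityMeasure (systemLaw M N) := by unfold systemLaw; infer_instance

/-! ### Unitary invariance of the Gaussian law. -/

theorem charFun_complexGaussian (t : ℂ) :
    charFun complexGaussian t = Complex.exp (-(‖t‖ ^ 2 : ℝ) / 4) := by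
  rw [complexGaussian, charFun_apply, integral_map measurable_complex_mk.aemeasurable (by fun_prop)]
  have h : ∀ p : ℝ × ℝ, Complex.exp ((inner ℝ (⟨p.1, p.2⟩ : ℂ) t : ℝ) * Complex.I)
      = Complex.exp (t.re * p.1 * Complex.I) * Complex.exp (t.im * p.2 * Complex.I) := by
    intro p
    rw [← Complex.exp_add, Complex.inner]
    congr 1
    simp
    ring
  simp_rw [h]
  rw [integral_prod_mul (fun x : ℝ => Complex.exp (t.re * x * Complex.I))
    (fun y : ℝ => Complex.exp (t.im * y * Complex.I)), ← charFun_apply_real, ← charFun_apply_real,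
    charFun_gaussianReal, charFun_gaussianReal, ← Complex.exp_add]
  congr 1
  rw [Complex.sq_norm, Complex.normSq_apply]
  push_cast
  simp
  ring

theorem charFun_gaussianVector {M : ℕ} (t : CVec M) :
    charFun (gaussianVector M) t = Complex.exp (-(‖t‖ ^ 2 : ℝ) / 4) := by
  have := charFun_pi (E := fun _ : Fin M => ℂ) (μ := fun _ => complexGaussian) t
  refine (Eq.trans ?_ this).trans ?_
  · rfl
  simp_rw [charFun_complexGaussian]
  rw [← Complex.exp_sum, EuclideanSpace.norm_sq_eq]
  push_cast
  rw [← Finset.sum_div, Finset.sum_neg_distrib]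

theorem charFun_map_isometry {M : ℕ} (μ : Measure (CVec M)) (U : CVec M ≃ₗᵢ[ℂ] CVec M) (t : CVec M) :
    charFun (μ.map U) t = charFun μ (U.symm t) := by
  rw [charFun_apply, charFun_apply, integral_map (by fun_prop) (by fun_prop)]
  congr 1; ext x
  rw [real_inner_eq_re, real_inner_eq_re, ← U.inner_map_map x, U.apply_symm_apply]

/-- The characteristic function depends on the norm of its argument only. -/
theorem gaussianVector_map_isometry {M : ℕ} (U : CVec M ≃ₗᵢ[ℂ] CVec M) :
    (gaussianVector M).map U = gaussianVector M := by
  have : IsProbabilityMeasure ((gaussianVector M).map U) :=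
    Measure.isProbabilityMeasure_map (by fun_prop)
  apply Measure.ext_of_charFun
  ext t
  rw [charFun_map_isometry, charFun_gaussianVector, charFun_gaussianVector, U.symm.norm_map]

/-! ### The squared modulus of a complex Gaussian: exponential law. -/

theorem complexGaussian_eq_withDensity : complexGaussian =
    (volume : Measure ℂ).withDensity (fun z => ENNReal.ofReal (Real.pi⁻¹ * Real.exp (-‖z‖ ^ 2))) := by
  have e : (fun p : ℝ × ℝ => (⟨p.1, p.2⟩ : ℂ)) = Complex.measurableEquivRealProd.symm := rfl
  rw [complexGaussian, gaussianReal_of_var_ne_zero 0 (by norm_num),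
    prod_withDensity (by fun_prop) (by fun_prop), e]
  ext s hs
  rw [MeasurableEquiv.map_apply, withDensity_apply _ hs,
    withDensity_apply _ (Complex.measurableEquivRealProd.symm.measurable hs),
    ← (Complex.volume_preserving_equiv_real_prod.symm).setLIntegral_comp_preimage_emb
      (MeasurableEquiv.measurableEmbedding _)]
  rw [← Measure.volume_eq_prod]
  congr 1
  ext p
  rw [gaussianPDF, gaussianPDF, ← ENNReal.ofReal_mul (gaussianPDFReal_nonneg _ _ _)]
  congr 1
  rw [gaussianPDFReal, gaussianPDFReal]
  have : ‖Complex.measurableEquivRealProd.symm p‖ ^ 2 = p.1 ^ 2 + p.2 ^ 2 := by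
    rw [Complex.sq_norm, Complex.normSq_apply]
    change p.1 * p.1 + p.2 * p.2 = _
    ring
  rw [this]
  push_cast
  have h2 : (√(2 * Real.pi * (1 / 2)))⁻¹ * (√(2 * Real.pi * (1 / 2)))⁻¹ = Real.pi⁻¹ := by
    rw [← mul_inv, Real.mul_self_sqrt (by positivity)]
    congr 1; ring
  rw [mul_mul_mul_comm, h2, ← Real.exp_add]
  congr 2; ring

/-- Polar coordinates: the area π of the unit disc cancels the normalization of the density. -/
theorem integral_norm_complexGaussian (f : ℝ → ℝ) :
    ∫ z, f (‖z‖) ∂complexGaussian = ∫ r in Set.Ioi (0:ℝ), 2 * r * Real.exp (-r ^ 2) * f r := by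
  rw [complexGaussian_eq_withDensity, integral_withDensity_eq_integral_toReal_smul
    (by fun_prop) (by simp)]
  have := integral_fun_norm_addHaar (volume : Measure ℂ)
    (fun r => (Real.pi⁻¹ * Real.exp (-r ^ 2)) * f r)
  refine Eq.trans ?_ (this.trans ?_)
  · congr 1; ext z
    rw [ENNReal.toReal_ofReal (by positivity), smul_eq_mul]
  · rw [Complex.finrank_real_complex, Measure.real, Complex.volume_ball]
    simp only [nsmul_eq_mul, smul_eq_mul]
    rw [← integral_const_mul, ← integral_const_mul]
    congr 1; ext r
    simp
    field_simp

theorem integral_normSq_complexGaussian : ∫ z, ‖z‖ ^ 2 ∂complexGaussian = 1 := by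
  rw [integral_norm_complexGaussian (fun r => r ^ 2)]
  have := integral_rpow_mul_exp_neg_mul_rpow (p := 2) (q := 3) (b := 1) (by norm_num) (by norm_num)
    (by norm_num)
  norm_num at this
  calc _ = 2 * ∫ x in Set.Ioi (0:ℝ), x ^ 3 * Real.exp (-x ^ 2) := by
        rw [← integral_const_mul]; congr 1; ext r; ring
    _ = 1 := by rw [this]; norm_num

theorem integrable_normSq_complexGaussian :
    Integrable (fun z : ℂ => ‖z‖ ^ 2) complexGaussian :=
  integrable_of_integral_eq_one integral_normSq_complexGaussian

theorem integral_exp_normSq_complexGaussian {s : ℝ} (hs : 0 ≤ s) :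
    ∫ z, Real.exp (-(s * ‖z‖ ^ 2)) ∂complexGaussian = (1 + s)⁻¹ := by
  rw [integral_norm_complexGaussian (fun r => Real.exp (-(s * r ^ 2)))]
  have := integral_rpow_mul_exp_neg_mul_rpow (p := 2) (q := 1) (b := 1 + s) (by norm_num)
    (by norm_num) (by positivity)
  norm_num [Real.rpow_neg_one] at this
  calc _ = 2 * ∫ x in Set.Ioi (0:ℝ), x * Real.exp (-((1 + s) * x ^ 2)) := by
        rw [← integral_const_mul]; congr 1; ext r
        rw [mul_assoc, ← Real.exp_add]; ring_nf
    _ = (1 + s)⁻¹ := by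
        have e : ∀ x : ℝ, -((1 + s) * x ^ 2) = (-s + -1) * x ^ 2 := fun x => by ring
        simp_rw [e, this]
        ring

theorem complexGaussian_tail {a : ℝ} (ha : 0 ≤ a) :
    complexGaussian.real {z : ℂ | a ≤ ‖z‖ ^ 2} = Real.exp (-a) := by
  have hm : MeasurableSet {z : ℂ | a ≤ ‖z‖ ^ 2} := measurableSet_le (by fun_prop) (by fun_prop)
  have h := integral_norm_complexGaussian (Set.indicator {r | √a ≤ r} 1)
  have e : (fun z : ℂ => Set.indicator {r : ℝ | √a ≤ r} (1 : ℝ → ℝ) ‖z‖) =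
      Set.indicator {z : ℂ | a ≤ ‖z‖ ^ 2} 1 := by
    ext z
    simp only [Set.indicator, Set.mem_ofPred_eq, Real.sqrt_le_left (norm_nonneg z)]
    simp
  rw [e, integral_indicator_one hm] at h
  rw [h]
  have e2 : ∀ r, 2 * r * Real.exp (-r ^ 2) * Set.indicator {r | √a ≤ r} (1 : ℝ → ℝ) r =
      Set.indicator (Set.Ici (√a)) (fun r => 2 * r * Real.exp (-r ^ 2)) r := by
    intro r
    by_cases hr : √a ≤ r <;> simp [Set.indicator, hr]
  simp_rw [e2]
  rw [setIntegral_indicator measurableSet_Ici,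
    setIntegral_congr_set ((ae_eq_refl _).inter Ioi_ae_eq_Ici.symm), Set.Ioi_inter_Ioi,
    sup_eq_right.2 (Real.sqrt_nonneg a)]
  have hd : ∀ r ∈ Set.Ici √a, HasDerivAt (fun r : ℝ => -Real.exp (-r ^ 2))
      (2 * r * Real.exp (-r ^ 2)) r := by
    intro r _
    have := ((hasDerivAt_pow 2 r).neg.exp).neg
    convert! this using 1
    simp; ring
  have ht : Tendsto (fun r : ℝ => -Real.exp (-r ^ 2)) atTop (𝓝 0) := by
    rw [← neg_zero]
    exact (Real.tendsto_exp_neg_atTop_nhds_zero.comp (tendsto_pow_atTop two_ne_zero)).neg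
  rw [integral_Ioi_of_hasDerivAt_of_nonneg' hd _ ht]
  · simp [Real.sq_sqrt ha]
  · intro r hr
    have : 0 ≤ r := (Real.sqrt_nonneg a).trans hr.le
    positivity

/-! ### Uniqueness of the isotropic law on the sphere. -/

theorem exists_isometry_map_eq {M : ℕ} {x y : CVec M} (hx : ‖x‖ = 1) (hy : ‖y‖ = 1) :
    ∃ U : CVec M ≃ₗᵢ[ℂ] CVec M, U x = y := by
  have hM : 0 < M := by
    rcases Nat.eq_zero_or_pos M with rfl | h
    · rw [Subsingleton.elim x 0] at hx; simp at hx
    · exact h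
  let i₀ : Fin M := ⟨0, hM⟩
  -- Both vectors are put in the same slot of an orthonormal basis; the change of basis is the
  -- required map.
  have key : ∀ z : CVec M, ‖z‖ = 1 → ∃ b : OrthonormalBasis (Fin M) ℂ (CVec M), b i₀ = z := by
    intro z hz
    obtain ⟨b, hb⟩ := Orthonormal.exists_orthonormalBasis_extension_of_card_eq
      (𝕜 := ℂ) (E := CVec M) (ι := Fin M) (by simp) (v := fun _ => z) (s := {i₀}) (by
        refine ⟨fun _ => hz, fun i j hij => (hij (Subsingleton.elim i j)).elim⟩)
    exact ⟨b, hb i₀ rfl⟩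
  obtain ⟨b, rfl⟩ := key x hx
  obtain ⟨c, rfl⟩ := key y hy
  exact ⟨b.equiv c (Equiv.refl _), by simp⟩

/-- Fubini: both sides are the double integral of exp(i t ⟨w, z⟩). -/
theorem charFun_swap {M : ℕ} (μ ν : Measure (CVec M)) [IsProbabilityMeasure μ]
    [IsProbabilityMeasure ν] (t : ℝ) :
    ∫ z, charFun μ (t • z) ∂ν = ∫ w, charFun ν (t • w) ∂μ := by
  simp_rw [charFun_apply]
  rw [integral_integral_swap]
  · congr 1; ext w; congr 1; ext z
    rw [inner_smul_right, inner_smul_right, real_inner_comm]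
  · apply Integrable.of_bound (C := 1)
    · apply Measurable.aestronglyMeasurable
      simp only [Function.uncurry_def]
      fun_prop
    · filter_upwards with p
      simp only [Function.uncurry_def]
      rw [Complex.norm_exp_ofReal_mul_I]

/-- A probability measure on the unit sphere that is invariant under all unitary maps is
unique. -/
theorem eq_of_isometry_invariant {M : ℕ} {μ ν : Measure (CVec M)} [IsProbabilityMeasure μ]
    [IsProbabilityMeasure ν] (hμ : ∀ U : CVec M ≃ₗᵢ[ℂ] CVec M, μ.map U = μ)
    (hν : ∀ U : CVec M ≃ₗᵢ[ℂ] CVec M, ν.map U = ν) (hμ1 : ∀ᵐ x ∂μ, ‖x‖ = 1)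
    (hν1 : ∀ᵐ x ∂ν, ‖x‖ = 1) : μ = ν := by
  have key : ∀ (μ : Measure (CVec M)), (∀ U : CVec M ≃ₗᵢ[ℂ] CVec M, μ.map U = μ) →
      ∀ (t : ℝ) (x y : CVec M), ‖x‖ = 1 → ‖y‖ = 1 →
      charFun μ (t • x) = charFun μ (t • y) := by
    intro μ hμ t x y hx hy
    obtain ⟨U, rfl⟩ := exists_isometry_map_eq hx hy
    conv_rhs => rw [← hμ U, charFun_map_isometry]
    congr 1
    have : t • U x = U ((t : ℂ) • x) := by rw [U.map_smul]; rfl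
    rw [this, U.symm_apply_apply]; rfl
  -- The characteristic function of an invariant measure is constant on spheres, so averaging it
  -- over any law on the unit sphere changes nothing. With `charFun_swap` this identifies the two
  -- characteristic functions.
  have avg : ∀ (μ ν : Measure (CVec M)) [IsProbabilityMeasure μ] [IsProbabilityMeasure ν],
      (∀ U : CVec M ≃ₗᵢ[ℂ] CVec M, μ.map U = μ) → (∀ᵐ x ∂ν, ‖x‖ = 1) →
      ∀ (t : ℝ) (x : CVec M), ‖x‖ = 1 → ∫ z, charFun μ (t • z) ∂ν = charFun μ (t • x) := by
    intro μ ν _ _ hμ hν t x hx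
    rw [integral_congr_ae (g := fun _ => charFun μ (t • x))]
    · simp
    · filter_upwards [hν] with z hz using key μ hμ t z x hz hx
  apply Measure.ext_of_charFun
  ext s
  by_cases hs : s = 0
  · simp [hs]
  · have hn : ‖s‖ ≠ 0 := norm_ne_zero_iff.2 hs
    have hx : ‖(‖s‖⁻¹ • s : CVec M)‖ = 1 := by
      rw [norm_smul, norm_inv, norm_norm, inv_mul_cancel₀ hn]
    have e : s = ‖s‖ • (‖s‖⁻¹ • s : CVec M) := by rw [smul_smul, mul_inv_cancel₀ hn, one_smul]
    rw [e, ← avg μ ν hμ hν1 ‖s‖ _ hx, ← avg ν μ hν hμ1 ‖s‖ _ hx, charFun_swap]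

theorem norm_unitDir {M : ℕ} {u : CVec M} (hu : u ≠ 0) : ‖unitDir u‖ = 1 := by
  have : ‖u‖ ≠ 0 := norm_ne_zero_iff.2 hu
  rw [unitDir, norm_smul, Complex.norm_real, norm_inv, norm_norm, inv_mul_cancel₀ this]

theorem norm_unitDir_le {M : ℕ} (u : CVec M) : ‖unitDir u‖ ≤ 1 := by
  by_cases hu : u = 0
  · simp [unitDir, hu]
  · exact (norm_unitDir hu).le

theorem unitDir_isometry {M : ℕ} (U : CVec M ≃ₗᵢ[ℂ] CVec M) (u : CVec M) :
    unitDir (U u) = U (unitDir u) := by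
  rw [unitDir, unitDir, U.norm_map, U.map_smul]

theorem isotropic_map_isometry {M : ℕ} (U : CVec M ≃ₗᵢ[ℂ] CVec M) :
    (isotropic M).map U = isotropic M := by
  have : (U ∘ unitDir : CVec M → CVec M) = unitDir ∘ U := by
    ext1 u; exact (unitDir_isometry U u).symm
  rw [isotropic, Measure.map_map (by fun_prop) measurable_unitDir, this,
    ← Measure.map_map measurable_unitDir (by fun_prop), gaussianVector_map_isometry]

/-! ### Proper subspaces are null sets; second moments. -/

theorem complexGaussian_singleton_zero : complexGaussian {0} = 0 := by
  rw [complexGaussian_eq_withDensity]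
  exact withDensity_absolutelyContinuous _ _ (by simp)

theorem gaussianVector_coord_zero {M : ℕ} (i : Fin M) :
    gaussianVector M {x | x i = 0} = 0 := by
  rw [gaussianVector, Measure.map_apply (by fun_prop)
    (measurableSet_eq_fun (by fun_prop) (by fun_prop))]
  have := Measure.quasiMeasurePreserving_eval (fun _ : Fin M => complexGaussian) i
  exact this.preimage_null complexGaussian_singleton_zero

/-- A proper subspace lies in the hyperplane orthogonal to some `a ≠ 0`; a unitary map turns it into
a coordinate hyperplane, which is null. -/
theorem gaussianVector_submodule {M : ℕ} {S : Submodule ℂ (CVec M)} (hS : S ≠ ⊤) :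
    gaussianVector M S = 0 := by
  obtain ⟨a, ha, ha0⟩ := Submodule.exists_mem_ne_zero_of_ne_bot
    (mt Submodule.orthogonal_eq_bot_iff.1 hS)
  have hM : 0 < M := by
    rcases Nat.eq_zero_or_pos M with rfl | h
    · exact (ha0 (Subsingleton.elim _ _)).elim
    · exact h
  let i₀ : Fin M := ⟨0, hM⟩
  obtain ⟨U, hU⟩ := exists_isometry_map_eq (norm_unitDir ha0)
    (y := EuclideanSpace.single i₀ (1 : ℂ)) (by simp)
  rw [← gaussianVector_map_isometry U.symm, Measure.map_apply (by fun_prop)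
    S.closed_of_finiteDimensional.measurableSet]
  refine measure_mono_null ?_ (gaussianVector_coord_zero i₀)
  intro x hx
  have h1 : inner ℂ (U.symm x) (unitDir a) = 0 := by
    rw [unitDir, inner_smul_right, (Submodule.mem_orthogonal _ _).1 ha _ hx, mul_zero]
  rw [← U.inner_map_map, hU, U.apply_symm_apply, EuclideanSpace.inner_single_right] at h1
  simpa using h1

theorem gaussianVector_ae_ne_zero {M : ℕ} (hM : 0 < M) : ∀ᵐ x ∂gaussianVector M, x ≠ 0 := by
  have : NeZero M := ⟨hM.ne'⟩
  have h : (⊥ : Submodule ℂ (CVec M)) ≠ ⊤ := bot_ne_top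
  have := gaussianVector_submodule h
  simpa [ae_iff] using this

theorem isotropic_submodule {M : ℕ} {S : Submodule ℂ (CVec M)} (hS : S ≠ ⊤) :
    isotropic M S = 0 := by
  rw [isotropic, Measure.map_apply measurable_unitDir
    S.closed_of_finiteDimensional.measurableSet]
  refine measure_mono_null ?_ (gaussianVector_submodule hS)
  intro x hx
  by_cases h0 : x = 0
  · simp [h0]
  · have : ‖x‖ ≠ 0 := norm_ne_zero_iff.2 h0
    have hx' : unitDir x ∈ S := hx
    rw [unitDir] at hx'
    exact (S.smul_mem_iff (by simpa using h0)).1 hx'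

theorem isotropic_ae_norm {M : ℕ} (hM : 0 < M) : ∀ᵐ x ∂isotropic M, ‖x‖ = 1 := by
  rw [isotropic, ae_map_iff measurable_unitDir.aemeasurable
    (measurableSet_eq_fun (by fun_prop) (by fun_prop))]
  filter_upwards [gaussianVector_ae_ne_zero hM] with x hx using norm_unitDir hx

theorem integrable_normSq_gaussianVector (M : ℕ) :
    Integrable (fun x => ‖x‖ ^ 2) (gaussianVector M) := by
  rw [gaussianVector, integrable_map_measure (by fun_prop) (by fun_prop)]
  have : ((fun x : CVec M => ‖x‖ ^ 2) ∘ WithLp.toLp 2) = fun x : Fin M → ℂ => ∑ i, ‖x i‖ ^ 2 := by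
    ext x; simp [EuclideanSpace.norm_sq_eq]
  rw [this]
  exact integrable_finsetSum _ fun i _ => integrable_comp_eval
    (μ := fun _ : Fin M => complexGaussian) (i := i) (f := fun z : ℂ => ‖z‖ ^ 2)
    integrable_normSq_complexGaussian

theorem integral_normSq_gaussianVector (M : ℕ) :
    ∫ x, ‖x‖ ^ 2 ∂gaussianVector M = M := by
  rw [gaussianVector, integral_map (by fun_prop) (by fun_prop)]
  simp_rw [EuclideanSpace.norm_sq_eq]
  rw [integral_finsetSum _ fun i _ => integrable_comp_eval
    (μ := fun _ : Fin M => complexGaussian) (i := i) (f := fun z : ℂ => ‖z‖ ^ 2)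
    integrable_normSq_complexGaussian]
  have : ∀ i : Fin M, ∫ x : Fin M → ℂ, ‖x i‖ ^ 2 ∂Measure.pi (fun _ => complexGaussian) = 1 := by
    intro i
    rw [integral_comp_eval (μ := fun _ : Fin M => complexGaussian) (i := i)
      (f := fun z : ℂ => ‖z‖ ^ 2) (by fun_prop),
      integral_normSq_complexGaussian]
  simp [this]

/-! ### Resampling one coordinate of a product measure. -/

theorem measurable_update_pair {ι : Type*} [DecidableEq ι] {α : Type*} [MeasurableSpace α]
    (i : ι) : Measurable (fun p : (ι → α) × α => Function.update p.1 i p.2) := by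
  rw [measurable_pi_iff]
  intro j
  by_cases h : j = i
  · subst h; simpa using measurable_snd
  · simp only [Function.update_of_ne h]; fun_prop

/-- Replacing one coordinate of a product measure by an independent copy does not change the
law. -/
theorem map_update_pi {ι : Type*} [Fintype ι] [DecidableEq ι] {α : Type*} [MeasurableSpace α]
    (μ : ι → Measure α) [∀ i, IsProbabilityMeasure (μ i)] (i : ι) :
    ((Measure.pi μ).prod (μ i)).map (fun p => Function.update p.1 i p.2) = Measure.pi μ := by
  have hm := measurable_update_pair (α := α) i
  symm
  apply Measure.pi_eq
  intro s hs
  rw [Measure.map_apply hm (MeasurableSet.univ_pi hs)]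
  have e : (fun p : (ι → α) × α => Function.update p.1 i p.2) ⁻¹' Set.univ.pi s =
      (Set.univ.pi (Function.update s i Set.univ)) ×ˢ s i := by
    ext p
    simp only [Set.mem_preimage, Set.mem_pi, Set.mem_univ, true_imp_iff, Set.mem_prod]
    constructor
    · intro h
      refine ⟨fun j => ?_, by simpa using h i⟩
      by_cases hj : j = i
      · subst hj; simp
      · simpa [hj] using h j
    · rintro ⟨h, h'⟩ j
      by_cases hj : j = i
      · subst hj; simpa using h'
      · simpa [hj] using h j
  rw [e, Measure.prod_prod, Measure.pi_pi, ← Finset.mul_prod_erase _ _ (Finset.mem_univ i),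
    ← Finset.mul_prod_erase Finset.univ (fun j => μ j (s j)) (Finset.mem_univ i)]
  simp only [Function.update_self, measure_univ, one_mul]
  rw [mul_comm]
  congr 1
  apply Finset.prod_congr rfl
  intro j hj
  rw [Function.update_of_ne (Finset.ne_of_mem_erase hj)]

/-- This is the form of conditioning on coordinate `i` that isolates one user from the others. -/
theorem lintegral_pi_update {ι : Type*} [Fintype ι] [DecidableEq ι] {α : Type*}
    [MeasurableSpace α] (μ : ι → Measure α) [∀ i, IsProbabilityMeasure (μ i)] (i : ι)
    {f : (ι → α) → ENNReal} (hf : Measurable f) :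
    ∫⁻ x, f x ∂Measure.pi μ = ∫⁻ y, ∫⁻ x, f (Function.update x i y) ∂Measure.pi μ ∂μ i := by
  conv_lhs => rw [← map_update_pi μ i]
  rw [lintegral_map hf (measurable_update_pair i),
    lintegral_prod_symm' (fun p => f (Function.update p.1 i p.2))
      (hf.comp (measurable_update_pair i))]


/-! ### Algebra of zero-forcing beams. -/

theorem continuous_rowMatrix {M : ℕ} : Continuous (rowMatrix : (Fin M → CVec M) → _) := by
  unfold rowMatrix
  refine continuous_matrix fun i k => ?_
  simp only [Matrix.of_apply]
  fun_prop

/-- A column of the adjugate of the channel matrix: a multiple of the zero-forcing beam. -/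
def adjCol {M : ℕ} (g : Fin M → CVec M) (i : Fin M) : CVec M :=
  WithLp.toLp 2 (fun k => (rowMatrix g).adjugate k i)

theorem continuous_adjCol {M : ℕ} (i : Fin M) :
    Continuous (fun g : Fin M → CVec M => adjCol g i) := by
  unfold adjCol
  refine (PiLp.continuous_toLp 2 _).comp (continuous_pi fun k => ?_)
  exact (continuous_rowMatrix.matrix_adjugate).matrix_elem k i

theorem continuous_det_rowMatrix {M : ℕ} :
    Continuous (fun g : Fin M → CVec M => (rowMatrix g).det) :=
  continuous_rowMatrix.matrix_det

/-- These are the entries of the identity A · adj A = det A · 1. -/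
theorem inner_adjCol {M : ℕ} (g : Fin M → CVec M) (i j : Fin M) :
    inner ℂ (g j) (adjCol g i) = if j = i then (rowMatrix g).det else 0 := by
  have h := congrFun (congrFun (Matrix.mul_adjugate (rowMatrix g)) j) i
  rw [Matrix.mul_apply, Matrix.smul_apply, Matrix.one_apply] at h
  rw [PiLp.inner_apply]
  simp only [smul_eq_mul, mul_ite, mul_one, mul_zero] at h
  rw [← h]
  refine Finset.sum_congr rfl fun k _ => ?_
  simp [adjCol, rowMatrix, mul_comm]

/-- Column `i` of the adjugate consists of the minors that omit row `i`. This is why the beam of a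
user ignores its own row, up to phase. -/
theorem adjCol_update {M : ℕ} (g : Fin M → CVec M) (i : Fin M) (y : CVec M) :
    adjCol (Function.update g i y) i = adjCol g i := by
  unfold adjCol
  congr 1
  ext k
  rw [Matrix.adjugate_apply, Matrix.adjugate_apply]
  congr 1
  ext j l
  by_cases h : j = i
  · subst h; simp
  · simp [h, rowMatrix]

theorem det_rowMatrix_update {M : ℕ} (g : Fin M → CVec M) (i : Fin M) (y : CVec M) :
    (rowMatrix (Function.update g i y)).det = inner ℂ y (adjCol g i) := by
  have := inner_adjCol (Function.update g i y) i i
  rw [adjCol_update] at this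
  simpa using this.symm

theorem zfBeam_eq {M : ℕ} (g : Fin M → CVec M) (i : Fin M) :
    zfBeam g i = unitDir ((rowMatrix g).det⁻¹ • adjCol g i) := by
  rw [zfBeam, Matrix.inv_def, Ring.inverse_eq_inv']
  congr 1

theorem measurable_zfBeam {M : ℕ} (i : Fin M) :
    Measurable (fun g : Fin M → CVec M => zfBeam g i) := by
  simp_rw [zfBeam_eq]
  exact measurable_unitDir.comp
    (continuous_det_rowMatrix.measurable.inv.smul (continuous_adjCol i).measurable)

theorem norm_zfBeam_le {M : ℕ} (g : Fin M → CVec M) (i : Fin M) : ‖zfBeam g i‖ ≤ 1 :=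
  norm_unitDir_le _

theorem inner_zfBeam_of_ne {M : ℕ} (g : Fin M → CVec M) {i j : Fin M} (h : j ≠ i) :
    inner ℂ (g j) (zfBeam g i) = 0 := by
  rw [zfBeam_eq, unitDir, inner_smul_right, inner_smul_right, inner_adjCol, if_neg h]
  simp

/-- After normalization the determinant contributes only a phase. Unlike the inverse, the adjugate
column does not involve row `i`. -/
theorem norm_inner_zfBeam {M : ℕ} {g : Fin M → CVec M} (hg : (rowMatrix g).det ≠ 0)
    (i : Fin M) (x : CVec M) :
    ‖inner ℂ x (zfBeam g i)‖ = ‖inner ℂ x (unitDir (adjCol g i))‖ := by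
  have : ‖(rowMatrix g).det‖ ≠ 0 := norm_ne_zero_iff.2 hg
  rw [zfBeam_eq, unitDir, unitDir, inner_smul_right, inner_smul_right, inner_smul_right]
  simp only [norm_mul, norm_smul, norm_inv, Complex.norm_real, norm_norm, mul_inv_rev, inv_inv]
  field_simp

theorem inner_zfBeam_self_ne_zero {M : ℕ} {g : Fin M → CVec M} (hg : (rowMatrix g).det ≠ 0)
    (i : Fin M) : inner ℂ (g i) (zfBeam g i) ≠ 0 := by
  have h : inner ℂ (g i) (adjCol g i) ≠ 0 := by rw [inner_adjCol, if_pos rfl]; exact hg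
  rw [← norm_ne_zero_iff, norm_inner_zfBeam hg, norm_ne_zero_iff, unitDir, inner_smul_right]
  refine mul_ne_zero ?_ h
  have : adjCol g i ≠ 0 := by rintro h0; simp [h0] at h
  simpa using this

/-- The gain of a zero-forcing beam does not depend on the row of its own user. -/
theorem norm_inner_zfBeam_update {M : ℕ} {g : Fin M → CVec M} {i : Fin M} {y : CVec M}
    (hg : (rowMatrix g).det ≠ 0) (hy : (rowMatrix (Function.update g i y)).det ≠ 0) (x : CVec M) :
    ‖inner ℂ x (zfBeam (Function.update g i y) i)‖ = ‖inner ℂ x (zfBeam g i)‖ := by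
  rw [norm_inner_zfBeam hg, norm_inner_zfBeam hy, adjCol_update]

/-- A unit vector that is orthogonal to all rows but the `i`-th, and has a positive
product with the latter, is the zero-forcing beam. -/
theorem zfBeam_unique {M : ℕ} {g : Fin M → CVec M} (hg : (rowMatrix g).det ≠ 0) {i : Fin M}
    {u : CVec M} {c : ℝ} (hc : 0 < c) (h : ∀ j, inner ℂ (g j) u = if j = i then (c : ℂ) else 0) :
    zfBeam g i = unitDir u := by
  have hu : WithLp.toLp 2 (fun k => (rowMatrix g)⁻¹ k i) = ((c⁻¹ : ℝ) : ℂ) • u := by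
    have h1 : (rowMatrix g).mulVec (WithLp.ofLp u) = (c : ℂ) • Pi.single i 1 := by
      ext j
      have := h j
      rw [PiLp.inner_apply] at this
      rw [Matrix.mulVec, dotProduct]
      refine Eq.trans (Finset.sum_congr rfl fun k _ => ?_) (this.trans ?_)
      · simp [rowMatrix, mul_comm]
      · by_cases hj : j = i <;> simp [hj]
    have h2 : WithLp.ofLp u = (c : ℂ) • fun k => (rowMatrix g)⁻¹ k i := by
      have := congrArg (fun v => (rowMatrix g)⁻¹.mulVec v) h1
      simp only [Matrix.mulVec_mulVec,
        Matrix.nonsing_inv_mul _ (isUnit_iff_ne_zero.2 hg), Matrix.one_mulVec] at this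
      rw [this, Matrix.mulVec_smul, Matrix.mulVec_single_one]
      rfl
    have hc' : (c : ℂ) ≠ 0 := by exact_mod_cast hc.ne'
    ext k
    simp [h2, hc']
  rw [zfBeam, hu, unitDir, unitDir, smul_smul, norm_smul]
  congr 1
  rw [Complex.norm_real, Real.norm_of_nonneg (inv_nonneg.2 hc.le)]
  rw [← Complex.ofReal_mul]
  congr 1
  field_simp

theorem inner_inv_det_smul_adjCol {M : ℕ} {g : Fin M → CVec M} (hg : (rowMatrix g).det ≠ 0)
    (i j : Fin M) :
    inner ℂ (g j) ((rowMatrix g).det⁻¹ • adjCol g i) = if j = i then 1 else 0 := by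
  rw [inner_smul_right, inner_adjCol]
  split_ifs
  · exact inv_mul_cancel₀ hg
  · simp

theorem zfBeam_smul {M : ℕ} {g : Fin M → CVec M} {i : Fin M} {r : Fin M → ℝ} (hr : 0 < r i)
    (hg : (rowMatrix g).det ≠ 0) (hg' : (rowMatrix fun j => (r j : ℂ) • g j).det ≠ 0) :
    zfBeam (fun j => (r j : ℂ) • g j) i = zfBeam g i := by
  rw [zfBeam_eq g]
  apply zfBeam_unique hg' hr
  intro j
  rw [inner_smul_left, inner_inv_det_smul_adjCol hg]
  by_cases h : j = i
  · subst h; simp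
  · simp [h]

theorem zfBeam_of_det_eq_zero {M : ℕ} {g : Fin M → CVec M} (hg : (rowMatrix g).det = 0)
    (i : Fin M) : zfBeam g i = 0 := by
  rw [zfBeam_eq, hg]; simp [unitDir]

/-- Applying `U` to the rows multiplies the row matrix on the right by a fixed matrix. -/
theorem det_rowMatrix_isometry_eq_zero {M : ℕ} (U : CVec M ≃ₗᵢ[ℂ] CVec M) {g : Fin M → CVec M}
    (hg : (rowMatrix g).det = 0) : (rowMatrix fun j => U (g j)).det = 0 := by
  let V : Matrix (Fin M) (Fin M) ℂ := fun l k => star (U (EuclideanSpace.single l 1) k)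
  have : (rowMatrix fun j => U (g j)) = rowMatrix g * V := by
    ext j k
    have h : g j = ∑ l, g j l • EuclideanSpace.single l (1 : ℂ) := by
      ext m
      simp [Finset.sum_apply, Pi.single_apply]
    rw [Matrix.mul_apply]
    simp only [rowMatrix, Matrix.of_apply]
    conv_lhs => rw [h]
    simp only [map_sum, map_smul, V]
    simp
  rw [this, Matrix.det_mul, hg, zero_mul]

/-- No invertibility is needed: for singular row matrices both beams take the default value 0. -/
theorem zfBeam_isometry {M : ℕ} (U : CVec M ≃ₗᵢ[ℂ] CVec M) (g : Fin M → CVec M) (i : Fin M) :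
    zfBeam (fun j => U (g j)) i = U (zfBeam g i) := by
  by_cases hg : (rowMatrix g).det = 0
  · rw [zfBeam_of_det_eq_zero hg, zfBeam_of_det_eq_zero (det_rowMatrix_isometry_eq_zero U hg),
      map_zero]
  · have hg' : (rowMatrix fun j => U (g j)).det ≠ 0 := by
      intro h
      apply hg
      simpa using det_rowMatrix_isometry_eq_zero U.symm h
    rw [zfBeam_eq g, ← unitDir_isometry]
    apply zfBeam_unique hg' one_pos
    intro j
    rw [U.inner_map_map, inner_inv_det_smul_adjCol hg]
    simp

/-! ### Almost sure invertibility of the channel matrices. -/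

/-- Independent vectors whose laws do not charge proper subspaces are almost surely linearly
independent. -/
theorem ae_det_rowMatrix_ne_zero {M : ℕ} (μ : Fin M → Measure (CVec M))
    [∀ i, IsProbabilityMeasure (μ i)]
    (hμ : ∀ i, ∀ S : Submodule ℂ (CVec M), S ≠ ⊤ → μ i S = 0) :
    ∀ᵐ g ∂Measure.pi μ, (rowMatrix g).det ≠ 0 := by
  -- The rows of the identity matrix are replaced by random rows one at a time, by induction on the
  -- set of replaced rows.
  let c : Fin M → CVec M := fun i => EuclideanSpace.single i 1
  have hc : rowMatrix c = 1 := by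
    ext i k
    by_cases h : i = k
    · subst h; simp [rowMatrix, c]
    · simp [rowMatrix, c, h, Ne.symm h]
  have key : ∀ s : Finset (Fin M), ∀ᵐ g ∂Measure.pi μ, (rowMatrix (s.piecewise g c)).det ≠ 0 := by
    intro s
    induction s using Finset.induction_on with
    | empty => simp [hc]
    | insert i s hi ih =>
      have hcont : Continuous (fun g : Fin M → CVec M => (insert i s).piecewise g c) := by
        refine continuous_pi fun j => ?_
        by_cases hj : j ∈ insert i s
        · simp only [Finset.piecewise_eq_of_mem _ _ _ hj]; fun_prop
        · simp only [Finset.piecewise_eq_of_notMem _ _ _ hj]; fun_prop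
      have hm : MeasurableSet {g : Fin M → CVec M |
          (rowMatrix ((insert i s).piecewise g c)).det ≠ 0} :=
        ((continuous_det_rowMatrix.comp hcont).measurable (measurableSet_singleton 0)).compl
      rw [← map_update_pi μ i, ae_map_iff (measurable_update_pair i).aemeasurable hm]
      refine (Measure.ae_prod_iff_ae_ae (measurable_update_pair i hm)).2 ?_
      filter_upwards [ih] with g hg
      -- `S` is the set of rows `y` that make the determinant vanish. It is proper because the old
      -- row `c i` gives a nonzero determinant by induction.
      let S : Submodule ℂ (CVec M) := (ℂ ∙ adjCol (s.piecewise g c) i)ᗮ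
      have hS : S ≠ ⊤ := by
        intro h
        have h1 : c i ∈ S := by rw [h]; trivial
        have h2 := Submodule.mem_orthogonal_singleton_iff_inner_left.1 h1
        rw [← det_rowMatrix_update] at h2
        apply hg
        rw [← h2]
        congr 2
        rw [Function.eq_update_self_iff, Finset.piecewise_eq_of_notMem _ _ _ hi]
      have h3 : ∀ᵐ y ∂μ i, y ∉ S := by
        rw [ae_iff]; simpa using hμ i S hS
      filter_upwards [h3] with y hy h4
      apply hy
      rw [Submodule.mem_orthogonal_singleton_iff_inner_left, ← det_rowMatrix_update, ← h4]
      congr 2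
      ext1 j
      by_cases hj : j = i
      · subst hj; simp
      · by_cases hjs : j ∈ s <;> simp [Finset.piecewise, hj, hjs]
  have := key Finset.univ
  simpa using this

/-! ### The quantizer: measurability and isotropy. -/

theorem quantize_spec {M N : ℕ} (hN : 0 < N) (h : CVec M) (w : Fin N → CVec M) :
    ∃ j, quantize h w = w j ∧ ∀ k, ‖inner ℂ h (w k)‖ ≤ ‖inner ℂ h (w j)‖ := by
  have : Nonempty (Fin N) := ⟨⟨0, hN⟩⟩
  obtain ⟨j, -, hj⟩ := Finset.exists_max_image Finset.univ (fun k => ‖inner ℂ h (w k)‖)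
    Finset.univ_nonempty
  have hne : (bestIndices h w).Nonempty :=
    ⟨j, by classical exact Finset.mem_filter.2 ⟨Finset.mem_univ _, fun k => hj k (Finset.mem_univ k)⟩⟩
  refine ⟨_, by rw [quantize, dif_pos hne], ?_⟩
  have := Finset.min'_mem _ hne
  classical exact (Finset.mem_filter.1 this).2

theorem bestIndices_isometry {M N : ℕ} (U : CVec M ≃ₗᵢ[ℂ] CVec M) (h : CVec M)
    (w : Fin N → CVec M) : bestIndices (U h) (fun k => U (w k)) = bestIndices h w := by
  simp only [bestIndices, U.inner_map_map]

theorem quantize_isometry {M N : ℕ} (U : CVec M ≃ₗᵢ[ℂ] CVec M) (h : CVec M)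
    (w : Fin N → CVec M) : quantize (U h) (fun k => U (w k)) = U (quantize h w) := by
  unfold quantize
  simp only [bestIndices_isometry]
  split_ifs
  · rfl
  · simp

theorem measurable_quantize {M N : ℕ} :
    Measurable (fun p : CVec M × (Fin N → CVec M) => quantize p.1 p.2) := by
  classical
  have hbest : ∀ j, MeasurableSet {p : CVec M × (Fin N → CVec M) | j ∈ bestIndices p.1 p.2} := by
    intro j
    have : {p : CVec M × (Fin N → CVec M) | j ∈ bestIndices p.1 p.2} =
        ⋂ k, {p | ‖inner ℂ p.1 (p.2 k)‖ ≤ ‖inner ℂ p.1 (p.2 j)‖} := by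
      ext p; simp [bestIndices]
    rw [this]
    exact MeasurableSet.iInter fun k => measurableSet_le (by fun_prop) (by fun_prop)
  have hset : ∀ S : Finset (Fin N),
      MeasurableSet {p : CVec M × (Fin N → CVec M) | bestIndices p.1 p.2 = S} := by
    intro S
    have : {p : CVec M × (Fin N → CVec M) | bestIndices p.1 p.2 = S} =
        ⋂ j, {p | j ∈ bestIndices p.1 p.2 ↔ j ∈ S} := by
      ext p; simp [Finset.ext_iff]
    rw [this]
    refine MeasurableSet.iInter fun j => ?_
    by_cases hj : j ∈ S
    · simpa [hj] using hbest j
    · simp only [hj, iff_false]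
      exact (hbest j).compl
  -- The quantizer is split according to the finitely many possible sets of maximizing indices; on
  -- each piece it is a coordinate projection or 0.
  have : (fun p : CVec M × (Fin N → CVec M) => quantize p.1 p.2) = fun p =>
      ∑ S : Finset (Fin N), if bestIndices p.1 p.2 = S then
        (if hne : S.Nonempty then p.2 (S.min' hne) else 0) else 0 := by
    ext1 p
    rw [Finset.sum_ite_eq, if_pos (Finset.mem_univ _), quantize]
  rw [this]
  refine Finset.measurable_sum _ fun S _ => Measurable.ite (hset S) ?_ measurable_const
  split_ifs <;> fun_prop

/-- The joint law of the channel and of the codebook of a single user. -/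
def userLaw (M N : ℕ) : Measure (CVec M × (Fin N → CVec M)) :=
  (gaussianVector M).prod (Measure.pi (fun _ : Fin N => isotropic M))

instance (M N : ℕ) : IsProbabilityMeasure (userLaw M N) := by unfold userLaw; infer_instance

theorem userLaw_ae_codebook_norm {M : ℕ} (hM : 0 < M) (N : ℕ) :
    ∀ᵐ w ∂Measure.pi (fun _ : Fin N => isotropic M), ∀ k, ‖w k‖ = 1 := by
  rw [ae_all_iff]
  intro k
  exact (Measure.quasiMeasurePreserving_eval (fun _ : Fin N => isotropic M) k).ae
    (isotropic_ae_norm hM)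

theorem userLaw_ae_norm_quantize {M N : ℕ} (hM : 0 < M) (hN : 0 < N) :
    ∀ᵐ p ∂userLaw M N, ‖quantize p.1 p.2‖ = 1 := by
  have : ∀ᵐ p ∂userLaw M N, ∀ k, ‖p.2 k‖ = 1 :=
    Measure.quasiMeasurePreserving_snd.ae (userLaw_ae_codebook_norm hM N)
  filter_upwards [this] with p hp
  obtain ⟨j, hj, -⟩ := quantize_spec hN p.1 p.2
  rw [hj, hp]

theorem userLaw_map_isometry {M N : ℕ} (U : CVec M ≃ₗᵢ[ℂ] CVec M) :
    (userLaw M N).map (Prod.map U (fun w k => U (w k))) = userLaw M N := by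
  have hcb : Measurable (fun (w : Fin N → CVec M) (k : Fin N) => U (w k)) := by fun_prop
  rw [userLaw, ← Measure.map_prod_map _ _ (by fun_prop) hcb, gaussianVector_map_isometry]
  have : ∀ i : Fin N, SigmaFinite ((isotropic M).map U) := fun i => by
    rw [isotropic_map_isometry]; infer_instance
  rw [Measure.pi_map_pi (f := fun _ : Fin N => U) (fun i => by fun_prop)]
  simp_rw [isotropic_map_isometry]

/-- The quantized channel is isotropic. -/
theorem map_quantize {M N : ℕ} (hM : 0 < M) (hN : 0 < N) :
    (userLaw M N).map (fun p => quantize p.1 p.2) = isotropic M := by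
  have : IsProbabilityMeasure ((userLaw M N).map (fun p => quantize p.1 p.2)) :=
    Measure.isProbabilityMeasure_map measurable_quantize.aemeasurable
  refine eq_of_isometry_invariant (fun U => ?_) isotropic_map_isometry ?_ (isotropic_ae_norm hM)
  · rw [Measure.map_map (by fun_prop) measurable_quantize]
    conv_rhs => rw [← userLaw_map_isometry U]
    rw [Measure.map_map measurable_quantize (by fun_prop)]
    congr 1
    ext1 p
    exact (quantize_isometry U p.1 p.2).symm
  · rw [ae_map_iff measurable_quantize.aemeasurable
      (measurableSet_eq_fun (by fun_prop) (by fun_prop))]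
    exact userLaw_ae_norm_quantize hM hN

/-! ### The quantization error of a random codebook. -/

theorem pi_complexGaussian_coord_tail {M : ℕ} (i : Fin M) {s : ℝ} (hs : 0 ≤ s) :
    Measure.pi (fun _ : Fin M => complexGaussian)
      {x | s * ∑ k ∈ Finset.univ.erase i, ‖x k‖ ^ 2 ≤ ‖x i‖ ^ 2} =
    ENNReal.ofReal ((1 + s)⁻¹ ^ (M - 1)) := by
  have hm : MeasurableSet {x : Fin M → ℂ |
      s * ∑ k ∈ Finset.univ.erase i, ‖x k‖ ^ 2 ≤ ‖x i‖ ^ 2} :=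
    measurableSet_le (by fun_prop) (by fun_prop)
  have hprod : ∀ x : Fin M → ℂ, Real.exp (-(s * ∑ k ∈ Finset.univ.erase i, ‖x k‖ ^ 2)) =
      ∏ k, (if k = i then (fun _ => 1) else fun z : ℂ => Real.exp (-(s * ‖z‖ ^ 2))) (x k) := by
    intro x
    rw [← Finset.mul_prod_erase _ _ (Finset.mem_univ i), if_pos rfl, one_mul, Finset.mul_sum,
      ← Finset.sum_neg_distrib, Real.exp_sum]
    refine Finset.prod_congr rfl fun k hk => ?_
    rw [if_neg (Finset.ne_of_mem_erase hk)]
  have hint : ∫ x : Fin M → ℂ, Real.exp (-(s * ∑ k ∈ Finset.univ.erase i, ‖x k‖ ^ 2))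
      ∂Measure.pi (fun _ : Fin M => complexGaussian) = (1 + s)⁻¹ ^ (M - 1) := by
    simp_rw [hprod]
    rw [integral_fintype_prod_eq_prod (μ := fun _ : Fin M => complexGaussian)
      (fun k => if k = i then (fun _ => 1) else fun z : ℂ => Real.exp (-(s * ‖z‖ ^ 2))),
      ← Finset.mul_prod_erase _ _ (Finset.mem_univ i), if_pos rfl,
      Finset.prod_congr (g := fun _ => (1 + s)⁻¹) rfl]
    · simp
    · intro k hk
      rw [if_neg (Finset.ne_of_mem_erase hk), integral_exp_normSq_complexGaussian hs]
  rw [← hint, ofReal_integral_eq_lintegral_ofReal]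
  -- Given the other coordinates, the exponential tail of ‖x i‖² at `s` times their energy is the
  -- exponential whose mean factors in `hint`.
  · rw [← map_update_pi (fun _ : Fin M => complexGaussian) i,
      Measure.map_apply (measurable_update_pair i) hm,
      Measure.prod_apply (measurable_update_pair i hm), map_update_pi]
    congr 1
    ext x
    rw [← complexGaussian_tail (mul_nonneg hs (Finset.sum_nonneg fun k _ => by positivity)),
      ofReal_measureReal]
    congr 1
    ext y
    simp only [Set.mem_preimage, Set.mem_ofPred_eq, Function.update_self]
    rw [Finset.sum_congr rfl]
    intro k hk
    rw [Function.update_of_ne (Finset.ne_of_mem_erase hk)]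
  · refine Integrable.of_bound (C := 1) (Measurable.aestronglyMeasurable (by fun_prop))
      (ae_of_all _ fun x => ?_)
    rw [Real.norm_of_nonneg (Real.exp_nonneg _), Real.exp_le_one_iff]
    have := Finset.sum_nonneg (s := Finset.univ.erase i) fun k _ => sq_nonneg ‖x k‖
    nlinarith
  · exact ae_of_all _ fun x => Real.exp_nonneg _

/-- The squared modulus of the component of an isotropic vector along a fixed unit vector has the
beta law with parameters `1` and `M - 1`. -/
theorem isotropic_cap {M : ℕ} {e : CVec M} (he : ‖e‖ = 1) {z : ℝ}
    (hz : 0 < z) (hz1 : z ≤ 1) :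
    isotropic M {w | 1 - ‖inner ℂ e w‖ ^ 2 ≤ z} = ENNReal.ofReal (z ^ (M - 1)) := by
  have hM : 0 < M := by
    rcases Nat.eq_zero_or_pos M with rfl | h
    · rw [Subsingleton.elim e 0] at he; simp at he
    · exact h
  let i : Fin M := ⟨0, hM⟩
  obtain ⟨U, rfl⟩ := exists_isometry_map_eq (x := EuclideanSpace.single i (1 : ℂ)) (by simp) he
  have hms : ∀ e : CVec M, MeasurableSet {w : CVec M | 1 - ‖inner ℂ e w‖ ^ 2 ≤ z} := fun e =>
    measurableSet_le (by fun_prop) (by fun_prop)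
  rw [← isotropic_map_isometry U, Measure.map_apply (by fun_prop) (hms _), isotropic,
    Measure.map_apply measurable_unitDir (U.continuous.measurable (hms _)), gaussianVector,
    Measure.map_apply (by fun_prop) (measurable_unitDir (U.continuous.measurable (hms _)))]
  -- With s = (1 − z)/z one has (1 + s)⁻¹ = z, and sin² ≤ z says that the energy of coordinate `i`
  -- is at least `s` times the rest.
  have hs : 0 ≤ (1 - z) / z := by have := sub_nonneg.2 hz1; positivity
  have := pi_complexGaussian_coord_tail i hs
  have e1 : (1 + (1 - z) / z)⁻¹ = z := by field_simp; ring
  rw [e1] at this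
  rw [← this]
  apply measure_congr
  have h0 : ∀ᵐ x ∂Measure.pi (fun _ : Fin M => complexGaussian), (WithLp.toLp 2 x : CVec M) ≠ 0 := by
    have := gaussianVector_ae_ne_zero hM
    rw [gaussianVector] at this
    exact ae_of_ae_map (f := WithLp.toLp 2) (by fun_prop) this
  filter_upwards [h0] with x hx
  apply propext
  change 1 - ‖inner ℂ (U (EuclideanSpace.single i 1)) (U (unitDir (WithLp.toLp 2 x)))‖ ^ 2 ≤ z ↔
    (1 - z) / z * ∑ k ∈ Finset.univ.erase i, ‖x k‖ ^ 2 ≤ ‖x i‖ ^ 2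
  have hn : 0 < ‖(WithLp.toLp 2 x : CVec M)‖ ^ 2 := by
    have := norm_pos_iff.2 hx; positivity
  have hsum : ‖(WithLp.toLp 2 x : CVec M)‖ ^ 2 =
      ‖x i‖ ^ 2 + ∑ k ∈ Finset.univ.erase i, ‖x k‖ ^ 2 := by
    rw [EuclideanSpace.norm_sq_eq,
      Finset.add_sum_erase _ (fun k => ‖x k‖ ^ 2) (Finset.mem_univ i)]
  rw [U.inner_map_map, EuclideanSpace.inner_single_left, map_one, one_mul, unitDir]
  simp only [PiLp.smul_apply, norm_smul, mul_pow, Complex.norm_real, norm_inv, norm_norm, inv_pow]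
  rw [hsum] at hn ⊢
  set a := ‖x i‖ ^ 2
  set c := ∑ k ∈ Finset.univ.erase i, ‖x k‖ ^ 2
  rw [div_mul_eq_mul_div, div_le_iff₀ hz, sub_le_comm, ← div_eq_inv_mul, le_div_iff₀ hn]
  constructor <;> intro h <;> nlinarith

/-- Integrate the derivative of z (1 − z^m)^(N+1), which vanishes at both endpoints. This is the
recursion of the beta function. -/
theorem integral_one_sub_pow_succ {m : ℕ} (hm : 0 < m) (N : ℕ) :
    ∫ z in (0:ℝ)..1, (1 - z ^ m) ^ N =
      (1 + 1 / ((N + 1) * m)) * ∫ z in (0:ℝ)..1, (1 - z ^ m) ^ (N + 1) := by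
  have hd : ∀ z ∈ Set.uIcc (0:ℝ) 1, HasDerivAt (fun z : ℝ => z * (1 - z ^ m) ^ (N + 1))
      ((1 - z ^ m) ^ (N + 1) - (N + 1) * m * (z ^ m * (1 - z ^ m) ^ N)) z := by
    intro z _
    have h := (hasDerivAt_id z).mul (((hasDerivAt_pow m z).const_sub 1).pow (N + 1))
    convert! h using 1
    obtain ⟨k, rfl⟩ : ∃ k, m = k + 1 := ⟨m - 1, by omega⟩
    simp only [id, Nat.add_sub_cancel, Pi.pow_apply]
    push_cast
    ring
  have h := intervalIntegral.integral_eq_sub_of_hasDerivAt hd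
    (Continuous.intervalIntegrable (by fun_prop) _ _)
  have e : ∀ z : ℝ, (1 - z ^ m) ^ (N + 1) - (N + 1) * m * (z ^ m * (1 - z ^ m) ^ N) =
      (1 + (N + 1) * m) * (1 - z ^ m) ^ (N + 1) - (N + 1) * m * (1 - z ^ m) ^ N := by
    intro z; ring
  simp_rw [e] at h
  rw [intervalIntegral.integral_sub (Continuous.intervalIntegrable (by fun_prop) _ _)
    (Continuous.intervalIntegrable (by fun_prop) _ _), intervalIntegral.integral_const_mul,
    intervalIntegral.integral_const_mul] at h
  simp at h
  have hm' : (0:ℝ) < m := by exact_mod_cast hm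
  have hN : (0:ℝ) < N + 1 := by positivity
  field_simp
  linarith

/-- Induction through the recursion, where Bernoulli's inequality (1 + 1/(N+1))^(1/m) ≤ 1 + 1/((N+1)
m) is exactly what the step requires. Having N + 1 rather than N as the base later makes the rate
bound strict. -/
theorem integral_one_sub_pow_le {m : ℕ} (hm : 0 < m) (N : ℕ) :
    ∫ z in (0:ℝ)..1, (1 - z ^ m) ^ N ≤ ((N : ℝ) + 1) ^ (-(1 / (m : ℝ))) := by
  induction N with
  | zero => simp
  | succ N ih =>
    rw [integral_one_sub_pow_succ hm] at ih
    have hm' : (1:ℝ) ≤ m := by exact_mod_cast hm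
    have hN : (0:ℝ) < N + 1 := by positivity
    set A := ∫ z in (0:ℝ)..1, (1 - z ^ m) ^ (N + 1)
    have hb : (1 + 1 / ((N : ℝ) + 1)) ^ (1 / (m : ℝ)) ≤ 1 + (1 / (m : ℝ)) * (1 / (N + 1)) :=
      rpow_one_add_le_one_add_mul_self
        (by have : 0 ≤ 1 / ((N : ℝ) + 1) := by positivity
            linarith) (by positivity)
        (by rw [div_le_one (by positivity)]; exact hm')
    have e1 : (1 / (m : ℝ)) * (1 / (N + 1)) = 1 / ((N + 1) * m) := by field_simp
    have e2 : (1 + 1 / ((N : ℝ) + 1)) = ((N + 1 : ℝ) + 1) / (N + 1) := by field_simp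
    rw [e1, e2, Real.div_rpow (by positivity) hN.le] at hb
    push_cast
    rw [Real.rpow_neg (by positivity)] at ih ⊢
    have hp : 0 < ((N : ℝ) + 1 + 1) ^ (1 / (m : ℝ)) := by positivity
    have hq : 0 < ((N : ℝ) + 1) ^ (1 / (m : ℝ)) := by positivity
    have hA : 0 ≤ A := intervalIntegral.integral_nonneg zero_le_one fun z hz => by
      have := pow_le_one₀ (n := m) hz.1 hz.2
      have : 0 ≤ 1 - z ^ m := by linarith
      positivity
    rw [← one_div, le_div_iff₀ hp]
    rw [← one_div, le_div_iff₀ hq] at ih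
    rw [div_le_iff₀ hq] at hb
    nlinarith

theorem measurable_quantize_right {M N : ℕ} (h : CVec M) :
    Measurable (fun w : Fin N → CVec M => quantize h w) :=
  Measurable.comp (g := fun p : CVec M × (Fin N → CVec M) => quantize p.1 p.2)
    (f := fun w => (h, w)) measurable_quantize measurable_prodMk_left

/-- Normalizing `h` scales all the inner products by the same factor, so the maximizer for `h` is
also one for its direction. -/
theorem quantize_error_le {M N : ℕ} (hN : 0 < N) (h : CVec M) (w : Fin N → CVec M) (k : Fin N) :
    1 - ‖inner ℂ (unitDir h) (quantize h w)‖ ^ 2 ≤ 1 - ‖inner ℂ (unitDir h) (w k)‖ ^ 2 := by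
  obtain ⟨j, hj, hk⟩ := quantize_spec hN h w
  rw [hj]
  have : ‖inner ℂ (unitDir h) (w k)‖ ≤ ‖inner ℂ (unitDir h) (w j)‖ := by
    simp only [unitDir, inner_smul_left, norm_mul]
    exact mul_le_mul_of_nonneg_left (hk k) (norm_nonneg _)
  gcongr

/-- The error exceeds `z` only if all N independent codebook vectors miss the cap. -/
theorem quantize_error_tail {M N : ℕ} (hN : 0 < N) {h : CVec M} (hh : h ≠ 0) {z : ℝ}
    (hz : 0 < z) (hz1 : z ≤ 1) :
    Measure.pi (fun _ : Fin N => isotropic M)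
      {w | z < 1 - ‖inner ℂ (unitDir h) (quantize h w)‖ ^ 2} ≤
      ENNReal.ofReal ((1 - z ^ (M - 1)) ^ N) := by
  have hp : 0 ≤ z ^ (M - 1) := pow_nonneg hz.le _
  have hp1 : z ^ (M - 1) ≤ 1 := pow_le_one₀ hz.le hz1
  let A : Set (CVec M) := {w | 1 - ‖inner ℂ (unitDir h) w‖ ^ 2 ≤ z}
  have hA : isotropic M Aᶜ = ENNReal.ofReal (1 - z ^ (M - 1)) := by
    rw [prob_compl_eq_one_sub (measurableSet_le (by fun_prop) (by fun_prop)),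
      isotropic_cap (norm_unitDir hh) hz hz1, ← ENNReal.ofReal_one, ← ENNReal.ofReal_sub _ hp]
  calc _ ≤ Measure.pi (fun _ : Fin N => isotropic M) (Set.univ.pi fun _ : Fin N => Aᶜ) :=
        measure_mono fun w hw k _ => not_le.2 (lt_of_lt_of_le hw (quantize_error_le hN h w k))
    _ = ENNReal.ofReal ((1 - z ^ (M - 1)) ^ N) := by
        rw [Measure.pi_pi, hA, Finset.prod_const, Finset.card_univ, Fintype.card_fin,
          ENNReal.ofReal_pow (by linarith)]

/-- The expected squared sine of the angle between a channel and its quantization. -/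
theorem lintegral_quantize_error_le {M N : ℕ} (hM : 0 < M) (hN : 0 < N) {h : CVec M}
    (hh : h ≠ 0) :
    ∫⁻ w, ENNReal.ofReal (1 - ‖inner ℂ (unitDir h) (quantize h w)‖ ^ 2)
      ∂Measure.pi (fun _ : Fin N => isotropic M) ≤
    ENNReal.ofReal (∫ z in (0:ℝ)..1, (1 - z ^ (M - 1)) ^ N) := by
  have hq := measurable_quantize_right (N := N) h
  -- Layer cake: the mean error is the integral of its tail, which vanishes beyond 1.
  rw [lintegral_eq_lintegral_meas_lt]
  rotate_left
  · filter_upwards [userLaw_ae_codebook_norm hM N] with w hw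
    obtain ⟨j, hj, -⟩ := quantize_spec hN h w
    have := norm_inner_le_norm (𝕜 := ℂ) (unitDir h) (quantize h w)
    rw [norm_unitDir hh, one_mul, hj, hw] at this
    rw [Pi.zero_apply, hj, sub_nonneg]
    exact pow_le_one₀ (norm_nonneg _) this
  · exact Measurable.aemeasurable (by fun_prop)
  have hbound : ∀ z ∈ Set.Ioi (0:ℝ), Measure.pi (fun _ : Fin N => isotropic M)
      {w | z < 1 - ‖inner ℂ (unitDir h) (quantize h w)‖ ^ 2} ≤
      Set.indicator (Set.Ioc (0:ℝ) 1) (fun z => ENNReal.ofReal ((1 - z ^ (M - 1)) ^ N)) z := by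
    intro z hz
    by_cases hz1 : z ≤ 1
    · rw [Set.indicator_of_mem (Set.mem_Ioc.2 ⟨hz, hz1⟩)]
      exact quantize_error_tail hN hh hz hz1
    · rw [Set.indicator_of_notMem (fun h => hz1 (Set.mem_Ioc.1 h).2)]
      have : {w : Fin N → CVec M | z < 1 - ‖inner ℂ (unitDir h) (quantize h w)‖ ^ 2} = ∅ := by
        refine Set.eq_empty_of_forall_notMem fun w hw => ?_
        have h1 : z < 1 - ‖inner ℂ (unitDir h) (quantize h w)‖ ^ 2 := hw
        have := sq_nonneg ‖inner ℂ (unitDir h) (quantize h w)‖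
        linarith
      rw [this, measure_empty]
  refine (setLIntegral_mono' measurableSet_Ioi hbound).trans ?_
  have hI : Set.Ioc (0:ℝ) 1 ∩ Set.Ioi 0 = Set.Ioc 0 1 :=
    Set.inter_eq_left.2 Set.Ioc_subset_Ioi_self
  rw [setLIntegral_indicator measurableSet_Ioc, hI,
    intervalIntegral.integral_of_le zero_le_one, ofReal_integral_eq_lintegral_ofReal]
  · have : Continuous fun z : ℝ => (1 - z ^ (M - 1)) ^ N := by fun_prop
    exact (this.integrableOn_Icc (a := 0) (b := 1)).mono_set Set.Ioc_subset_Icc_self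
  · filter_upwards [ae_restrict_mem measurableSet_Ioc] with z hz
    have := pow_le_one₀ (n := M - 1) hz.1.le hz.2
    have : 0 ≤ 1 - z ^ (M - 1) := by linarith
    exact pow_nonneg this _

/-! ### Equality in law of the signal powers. -/

section

attribute [local irreducible] quantize zfBeam

/-- The quantized channels of all the users. -/
def quantizedChannels {M N : ℕ} (ω : (Fin M → CVec M) × (Fin M → Fin N → CVec M)) :
    Fin M → CVec M := fun k => quantize (ω.1 k) (ω.2 k)

theorem measurable_quantizedChannels {M N : ℕ} :
    Measurable (quantizedChannels : (Fin M → CVec M) × (Fin M → Fin N → CVec M) → _) := by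
  refine measurable_pi_iff.2 fun k => ?_
  exact Measurable.comp (g := fun p : CVec M × (Fin N → CVec M) => quantize p.1 p.2)
    (f := fun ω : (Fin M → CVec M) × (Fin M → Fin N → CVec M) => (ω.1 k, ω.2 k))
    measurable_quantize (by fun_prop)

/-- The users are independent and identically distributed. -/
theorem measurePreserving_users (M N : ℕ) :
    MeasurePreserving (fun u : Fin M → CVec M × (Fin N → CVec M) =>
      ((fun k => (u k).1, fun k => (u k).2) : (Fin M → CVec M) × (Fin M → Fin N → CVec M)))
      (Measure.pi fun _ => userLaw M N) (systemLaw M N) :=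
  measurePreserving_arrowProdEquivProdArrow (CVec M) (Fin N → CVec M) (Fin M)
    (fun _ => gaussianVector M) (fun _ => Measure.pi fun _ => isotropic M)

theorem measurable_norm_inner_zfBeam {M : ℕ} (i j : Fin M) {α : Type*} [MeasurableSpace α]
    {x : α → Fin M → CVec M} {g : α → Fin M → CVec M} (hx : Measurable x) (hg : Measurable g) :
    Measurable fun a => ‖inner ℂ (x a i) (zfBeam (g a) j)‖ := by
  have h1 : Measurable fun a => zfBeam (g a) j := (measurable_zfBeam j).comp hg
  fun_prop

/-- Rows with one exceptional coordinate: the laws of the channel of user `i` and of the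
isotropic vectors of the others. -/
def mixedLaw (M : ℕ) (i k : Fin M) : Measure (CVec M) :=
  if k = i then gaussianVector M else isotropic M

instance (M : ℕ) (i k : Fin M) : IsProbabilityMeasure (mixedLaw M i k) := by
  unfold mixedLaw; split_ifs <;> infer_instance

theorem mixedLaw_submodule {M : ℕ} (i k : Fin M) (S : Submodule ℂ (CVec M)) (hS : S ≠ ⊤) :
    mixedLaw M i k S = 0 := by
  unfold mixedLaw
  split_ifs
  · exact gaussianVector_submodule hS
  · exact isotropic_submodule hS

/-- Distinct users are independent, and each quantized channel is isotropic. The result is the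
common law reached from perfect CSIT in `map_update_unitDir`. -/
theorem map_update_quantizedChannels {M N : ℕ} (hM : 0 < M) (hN : 0 < N) (i : Fin M) :
    MeasurePreserving (fun ω : (Fin M → CVec M) × (Fin M → Fin N → CVec M) =>
      Function.update (quantizedChannels ω) i (ω.1 i)) (systemLaw M N)
      (Measure.pi (mixedLaw M i)) := by
  have hm : Measurable (fun ω : (Fin M → CVec M) × (Fin M → Fin N → CVec M) =>
      Function.update (quantizedChannels ω) i (ω.1 i)) :=
    (measurable_update_pair i).comp (measurable_quantizedChannels.prodMk (by fun_prop))
  refine ⟨hm, ?_⟩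
  rw [← (measurePreserving_users M N).map_eq, Measure.map_map hm
    (measurePreserving_users M N).measurable]
  let f : Fin M → CVec M × (Fin N → CVec M) → CVec M := fun k =>
    if k = i then Prod.fst else fun p => quantize p.1 p.2
  have hf : ∀ k, Measurable (f k) := by
    intro k
    simp only [f]
    split_ifs
    · exact measurable_fst
    · exact measurable_quantize
  have hfm : ∀ k, (userLaw M N).map (f k) = mixedLaw M i k := by
    intro k
    simp only [f, mixedLaw]
    split_ifs
    · rw [userLaw, ← Measure.fst, Measure.fst_prod]
    · exact map_quantize hM hN
  have hs : ∀ k, SigmaFinite ((userLaw M N).map (f k)) := fun k => by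
    rw [hfm]; infer_instance
  have := Measure.pi_map_pi (μ := fun _ : Fin M => userLaw M N) (f := f)
    (fun k => (hf k).aemeasurable)
  simp_rw [hfm] at this
  rw [← this]
  congr 1
  ext1 u
  ext1 k
  by_cases hk : k = i
  · subst hk; simp [f]
  · simp [f, hk, quantizedChannels]

theorem map_quantizedChannels {M N : ℕ} (hM : 0 < M) (hN : 0 < N) :
    MeasurePreserving (fun u : Fin M → CVec M × (Fin N → CVec M) =>
      fun k => quantize (u k).1 (u k).2) (Measure.pi fun _ => userLaw M N)
      (Measure.pi fun _ => isotropic M) := by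
  refine ⟨measurable_quantizedChannels.comp (measurePreserving_users M N).measurable, ?_⟩
  have hs : ∀ _ : Fin M, SigmaFinite ((userLaw M N).map (fun p => quantize p.1 p.2)) :=
    fun k => by rw [map_quantize hM hN]; infer_instance
  have := Measure.pi_map_pi (μ := fun _ : Fin M => userLaw M N)
    (f := fun _ (p : CVec M × (Fin N → CVec M)) => quantize p.1 p.2)
    (fun k => measurable_quantize.aemeasurable)
  simp_rw [map_quantize hM hN] at this
  exact this

theorem map_update_unitDir {M : ℕ} (i : Fin M) :
    MeasurePreserving (fun h : Fin M → CVec M =>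
      Function.update (fun k => unitDir (h k)) i (h i)) (channelLaw M)
      (Measure.pi (mixedLaw M i)) := by
  have hu : Measurable (fun h : Fin M → CVec M => fun k => unitDir (h k)) :=
    measurable_pi_iff.2 fun k => measurable_unitDir.comp (by fun_prop)
  have hm : Measurable (fun h : Fin M → CVec M =>
      Function.update (fun k => unitDir (h k)) i (h i)) :=
    (measurable_update_pair i).comp (hu.prodMk (by fun_prop))
  refine ⟨hm, ?_⟩
  let f : Fin M → CVec M → CVec M := fun k => if k = i then id else unitDir
  have hf : ∀ k, Measurable (f k) := by
    intro k
    simp only [f]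
    split_ifs
    · exact measurable_id
    · exact measurable_unitDir
  have hfm : ∀ k, (gaussianVector M).map (f k) = mixedLaw M i k := by
    intro k
    simp only [f, mixedLaw]
    split_ifs
    · exact Measure.map_id
    · rfl
  have hs : ∀ k, SigmaFinite ((gaussianVector M).map (f k)) := fun k => by
    rw [hfm]; infer_instance
  have := Measure.pi_map_pi (μ := fun _ : Fin M => gaussianVector M) (f := f)
    (fun k => (hf k).aemeasurable)
  simp_rw [hfm] at this
  rw [← this]
  unfold channelLaw
  congr 1
  ext1 u
  ext1 k
  by_cases hk : k = i
  · subst hk; simp [f]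
  · simp [f, hk]

theorem channelLaw_ae_det (M : ℕ) : ∀ᵐ h ∂channelLaw M, (rowMatrix h).det ≠ 0 :=
  ae_det_rowMatrix_ne_zero _ fun _ _ hS => gaussianVector_submodule hS

/-- The beam gains of zero-forcing based on quantized and on perfect channel knowledge have the
same law. -/
theorem map_signal {M N : ℕ} (hM : 0 < M) (hN : 0 < N) (i : Fin M) :
    (systemLaw M N).map (fun ω => ‖inner ℂ (ω.1 i) (zfBeam (quantizedChannels ω) i)‖) =
    (channelLaw M).map (fun h => ‖inner ℂ (h i) (zfBeam h i)‖) := by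
  have hG : Measurable (fun g : Fin M → CVec M => ‖inner ℂ (g i) (zfBeam g i)‖) :=
    measurable_norm_inner_zfBeam i i measurable_id measurable_id
  have hdet := ae_det_rowMatrix_ne_zero (mixedLaw M i) (mixedLaw_submodule i)
  have h1 := map_update_quantizedChannels hM hN i
  have h2 := map_update_unitDir i
  have hq := (map_quantizedChannels (N := N) hM hN).quasiMeasurePreserving.ae
    (ae_det_rowMatrix_ne_zero _ fun _ _ hS => isotropic_submodule hS)
  have hq' : ∀ᵐ ω ∂systemLaw M N, (rowMatrix (quantizedChannels ω)).det ≠ 0 := by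
    rw [← (measurePreserving_users M N).map_eq, ae_map_iff
      (measurePreserving_users M N).measurable.aemeasurable]
    · exact hq
    · exact ((continuous_det_rowMatrix.measurable.comp measurable_quantizedChannels)
        (measurableSet_singleton 0)).compl
  -- Both signals are compared with the one where row `i` is `h_i` and the other rows are isotropic:
  -- changing row `i`, or rescaling the other rows, does not affect the gain of beam `i`.
  trans (Measure.pi (mixedLaw M i)).map (fun g => ‖inner ℂ (g i) (zfBeam g i)‖)
  · rw [← h1.map_eq, Measure.map_map hG h1.measurable]
    apply Measure.map_congr
    filter_upwards [hq', h1.quasiMeasurePreserving.ae hdet] with ω hω hω'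
    simp only [Function.comp_apply, Function.update_self]
    rw [norm_inner_zfBeam_update hω hω']
  · rw [← h2.map_eq, Measure.map_map hG h2.measurable]
    apply Measure.map_congr
    filter_upwards [channelLaw_ae_det M, h2.quasiMeasurePreserving.ae hdet] with h hh hh'
    simp only [Function.comp_apply, Function.update_self]
    have e : Function.update (fun k => unitDir (h k)) i (h i) =
        fun j => ((if j = i then 1 else ‖h j‖⁻¹ : ℝ) : ℂ) • h j := by
      ext1 j
      by_cases hj : j = i
      · subst hj; simp
      · simp [hj, unitDir]
    rw [e] at hh' ⊢
    rw [zfBeam_smul (r := fun j => if j = i then 1 else ‖h j‖⁻¹) (by simp) hh hh']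

/-! ### Mean interference power. -/

/-- The average gain of the beam of user `j` in the direction `x`, when row `i` is `q` and
the other rows are isotropic. -/
def leakage {M : ℕ} (i j : Fin M) (q x : CVec M) : ENNReal :=
  ∫⁻ g, ENNReal.ofReal (‖inner ℂ x (zfBeam (Function.update g i q) j)‖ ^ 2)
    ∂Measure.pi (fun _ : Fin M => isotropic M)

theorem measurable_zfBeam_update {M : ℕ} (i j : Fin M) (q : CVec M) :
    Measurable fun g : Fin M → CVec M => zfBeam (Function.update g i q) j :=
  (measurable_zfBeam j).comp
    ((measurable_update_pair i).comp (measurable_id.prodMk measurable_const))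

/-- Apply `U` to all rows: the isotropic ones keep their law, row `i` is fixed, and the beam is
equivariant. -/
theorem leakage_isometry {M : ℕ} (i j : Fin M) {q : CVec M} (x : CVec M)
    (U : CVec M ≃ₗᵢ[ℂ] CVec M) (hU : U q = q) : leakage i j q (U x) = leakage i j q x := by
  have hs : ∀ _ : Fin M, SigmaFinite ((isotropic M).map U) := fun i => by
    rw [isotropic_map_isometry]; infer_instance
  have hp : Measure.map (fun (g : Fin M → CVec M) k => U (g k)) (Measure.pi fun _ => isotropic M) =
      Measure.pi fun _ => isotropic M := by
    rw [Measure.pi_map_pi (f := fun _ : Fin M => U) (fun i => by fun_prop)]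
    simp_rw [isotropic_map_isometry]
  have hz := measurable_zfBeam_update i j q
  rw [leakage, ← hp, lintegral_map (by fun_prop) (by fun_prop), leakage]
  congr 1
  ext1 g
  have : Function.update (fun k => U (g k)) i q = fun k => U (Function.update g i q k) := by
    ext1 k
    by_cases hk : k = i
    · subst hk; simp [hU]
    · simp [hk]
  rw [this, zfBeam_isometry, U.inner_map_map]

theorem leakage_smul {M : ℕ} (i j : Fin M) (q x : CVec M) (c : ℂ) :
    leakage i j q (c • x) = ENNReal.ofReal (‖c‖ ^ 2) * leakage i j q x := by
  have hz := measurable_zfBeam_update i j q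
  rw [leakage, leakage, ← lintegral_const_mul _ (by fun_prop)]
  congr 1
  ext1 g
  rw [← ENNReal.ofReal_mul (by positivity), inner_smul_left, norm_mul, RCLike.norm_conj, mul_pow]

/-- Extend `q`, `x` to an orthonormal basis. The M − 1 vectors other than `q` have equal leakages by
symmetry, and these sum to at most the mean of ‖beam‖² ≤ 1. -/
theorem leakage_unit_le {M : ℕ} {i j : Fin M} (hij : j ≠ i) {q x : CVec M} (hq : ‖q‖ = 1)
    (hx : ‖x‖ = 1) (hqx : inner ℂ q x = 0) : ((M - 1 : ℕ) : ENNReal) * leakage i j q x ≤ 1 := by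
  obtain ⟨b, hb⟩ := Orthonormal.exists_orthonormalBasis_extension_of_card_eq
    (𝕜 := ℂ) (E := CVec M) (ι := Fin M) (by simp) (v := fun k => if k = i then q else x)
    (s := {i, j}) (by
      rw [orthonormal_iff_ite]
      have hxq : inner ℂ x q = 0 := by rw [← inner_conj_symm, hqx, map_zero]
      rintro ⟨k, rfl | rfl⟩ ⟨l, rfl | rfl⟩
      · simp [Set.domRestrict, hq]
      · rw [if_neg fun h => hij (Subtype.ext_iff.1 h).symm]
        simpa [Set.domRestrict, hij] using hqx
      · rw [if_neg fun h => hij (Subtype.ext_iff.1 h)]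
        simpa [Set.domRestrict, hij] using hxq
      · simp [Set.domRestrict, hij, hx])
  have hbi : b i = q := by rw [hb i (by simp), if_pos rfl]
  have hbj : b j = x := by rw [hb j (by simp), if_neg hij]
  have hk : ∀ k ∈ Finset.univ.erase i, leakage i j q (b k) = leakage i j q x := by
    intro k hk
    have hki := Finset.ne_of_mem_erase hk
    -- The unitary map that swaps the basis vectors `j` and `k` fixes `q`, which sits in slot `i`,
    -- and sends `x` to `b k`.
    have h1 : b.equiv b (Equiv.swap j k) q = q := by
      rw [← hbi, OrthonormalBasis.equiv_apply_basis,
        Equiv.swap_apply_of_ne_of_ne hij.symm hki.symm]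
    have h2 : b.equiv b (Equiv.swap j k) x = b k := by
      rw [← hbj, OrthonormalBasis.equiv_apply_basis, Equiv.swap_apply_left]
    rw [← h2, leakage_isometry _ _ _ _ h1]
  have hz := measurable_zfBeam_update i j q
  calc ((M - 1 : ℕ) : ENNReal) * leakage i j q x
      = ∑ k ∈ Finset.univ.erase i, leakage i j q (b k) := by
        rw [Finset.sum_congr rfl hk]; simp
    _ = ∫⁻ g, ∑ k ∈ Finset.univ.erase i,
          ENNReal.ofReal (‖inner ℂ (b k) (zfBeam (Function.update g i q) j)‖ ^ 2)
          ∂Measure.pi (fun _ : Fin M => isotropic M) := by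
        rw [lintegral_finsetSum _ fun k _ => by fun_prop]
        rfl
    _ ≤ ∫⁻ g, 1 ∂Measure.pi (fun _ : Fin M => isotropic M) := by
        apply lintegral_mono
        intro g
        refine (Finset.sum_le_sum_of_subset (Finset.erase_subset i Finset.univ)).trans ?_
        rw [← ENNReal.ofReal_sum_of_nonneg fun k _ => by positivity, b.sum_sq_norm_inner_right]
        rw [ENNReal.ofReal_le_one]
        exact pow_le_one₀ (norm_nonneg _) (norm_zfBeam_le _ _)
    _ = 1 := by simp

/-- Beam `j` annihilates `q`, so only the component `r` of `h` orthogonal to `q` leaks; the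
unit-vector bound applies to its direction. -/
theorem leakage_le {M : ℕ} (hM : 2 ≤ M) {i j : Fin M} (hij : j ≠ i) {q : CVec M} (hq : ‖q‖ = 1)
    (h : CVec M) :
    leakage i j q h ≤ ENNReal.ofReal ((‖h‖ ^ 2 - ‖inner ℂ q h‖ ^ 2) / ((M : ℝ) - 1)) := by
  set r : CVec M := h - inner ℂ q h • q with hr
  have hqq : inner ℂ q q = 1 := by rw [inner_self_eq_norm_sq_to_K, hq]; simp
  have hqr : inner ℂ q r = 0 := by
    rw [hr, inner_sub_right, inner_smul_right, hqq, mul_one, sub_self]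
  have hh : h = r + inner ℂ q h • q := by rw [hr]; abel
  have hnorm : ‖h‖ ^ 2 - ‖inner ℂ q h‖ ^ 2 = ‖r‖ ^ 2 := by
    have := norm_add_sq_eq_norm_sq_add_norm_sq_of_inner_eq_zero r (inner ℂ q h • q)
      (𝕜 := ℂ) (by rw [inner_smul_right, ← inner_conj_symm r q, hqr]; simp)
    rw [← hh, norm_smul, hq, mul_one] at this
    rw [sq, sq, sq, this]; ring
  have hleak : leakage i j q h = leakage i j q r := by
    unfold leakage
    congr 1
    ext1 g
    have : inner ℂ q (zfBeam (Function.update g i q) j) = 0 := by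
      have := inner_zfBeam_of_ne (Function.update g i q) hij.symm
      rwa [Function.update_self] at this
    conv_lhs => rw [hh, inner_add_left, inner_smul_left, this, mul_zero, add_zero]
  rw [hleak, hnorm]
  by_cases hr0 : r = 0
  · rw [hr0, leakage]; simp
  · have hrn : ‖r‖ ≠ 0 := norm_ne_zero_iff.2 hr0
    have h1 := leakage_unit_le hij hq (norm_unitDir hr0)
      (by rw [unitDir, inner_smul_right, hqr, mul_zero])
    have e : r = (‖r‖ : ℂ) • unitDir r := by
      rw [unitDir, smul_smul, ← Complex.ofReal_mul, mul_inv_cancel₀ hrn]; simp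
    have hM1 : (0 : ℝ) < (M : ℝ) - 1 := by
      have : (2 : ℝ) ≤ M := by exact_mod_cast hM
      linarith
    have e2 : ((M - 1 : ℕ) : ENNReal) = ENNReal.ofReal ((M : ℝ) - 1) := by
      rw [← ENNReal.ofReal_natCast]; congr 1; push_cast [show 1 ≤ M by omega]; ring
    rw [e2] at h1
    conv_lhs => rw [e, leakage_smul]
    rw [Complex.norm_real, norm_norm, div_eq_mul_inv, ENNReal.ofReal_mul (by positivity)]
    gcongr
    rw [ENNReal.ofReal_inv_of_pos hM1, ENNReal.le_inv_iff_mul_le, mul_comm]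
    exact h1

/-- Conditioning on the channel and codebook of user `i` leaves the other quantized channels iid
isotropic. -/
theorem lintegral_leakage {M N : ℕ} (hM : 0 < M) (hN : 0 < N) (i j : Fin M) :
    ∫⁻ ω, ENNReal.ofReal (‖inner ℂ (ω.1 i) (zfBeam (quantizedChannels ω) j)‖ ^ 2)
      ∂systemLaw M N = ∫⁻ y, leakage i j (quantize y.1 y.2) y.1 ∂userLaw M N := by
  have hF : Measurable fun ω : (Fin M → CVec M) × (Fin M → Fin N → CVec M) =>
      ENNReal.ofReal (‖inner ℂ (ω.1 i) (zfBeam (quantizedChannels ω) j)‖ ^ 2) :=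
    ((measurable_norm_inner_zfBeam i j measurable_fst
      measurable_quantizedChannels).pow_const 2).ennreal_ofReal
  rw [← (measurePreserving_users M N).lintegral_comp hF]
  refine (lintegral_pi_update (fun _ => userLaw M N) i
    (hF.comp (measurePreserving_users M N).measurable)).trans ?_
  refine lintegral_congr fun y => ?_
  have hz := measurable_zfBeam_update i j (quantize y.1 y.2)
  have hG : Measurable fun g : Fin M → CVec M => ENNReal.ofReal
      (‖inner ℂ y.1 (zfBeam (Function.update g i (quantize y.1 y.2)) j)‖ ^ 2) := by fun_prop
  rw [leakage, ← (map_quantizedChannels hM hN).lintegral_comp hG]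
  refine lintegral_congr fun u => ?_
  have : quantizedChannels ((fun k => (Function.update u i y k).1, fun k =>
        (Function.update u i y k).2) : (Fin M → CVec M) × (Fin M → Fin N → CVec M)) =
      Function.update (fun k => quantize (u k).1 (u k).2) i (quantize y.1 y.2) := by
    ext1 k
    by_cases hk : k = i
    · subst hk; simp [quantizedChannels]
    · simp [quantizedChannels, hk]
  simp only [Function.comp_apply]
  rw [this, Function.update_self]

/-- The bound on the mean quantization error is the same for every `h ≠ 0`, so it factors out,
leaving E‖h‖² = M. -/
theorem lintegral_interference_le {M N : ℕ} (hM : 2 ≤ M) (hN : 0 < N) {i j : Fin M}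
    (hij : j ≠ i) :
    ∫⁻ ω, ENNReal.ofReal (‖inner ℂ (ω.1 i) (zfBeam (quantizedChannels ω) j)‖ ^ 2)
      ∂systemLaw M N ≤
    ENNReal.ofReal (M / ((M : ℝ) - 1) * ∫ z in (0:ℝ)..1, (1 - z ^ (M - 1)) ^ N) := by
  have hM0 : 0 < M := by omega
  have hM1 : (0 : ℝ) < (M : ℝ) - 1 := by
    have : (2 : ℝ) ≤ M := by exact_mod_cast hM
    linarith
  set A := ∫ z in (0:ℝ)..1, (1 - z ^ (M - 1)) ^ N
  rw [lintegral_leakage hM0 hN]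
  have hne : ∀ᵐ y ∂userLaw M N, y.1 ≠ 0 :=
    Measure.quasiMeasurePreserving_fst.ae (gaussianVector_ae_ne_zero hM0)
  have hme : Measurable fun y : CVec M × (Fin N → CVec M) =>
      ENNReal.ofReal (1 - ‖inner ℂ (unitDir y.1) (quantize y.1 y.2)‖ ^ 2) := by
    have h1 := measurable_quantize (M := M) (N := N)
    have h2 : Measurable fun y : CVec M × (Fin N → CVec M) => unitDir y.1 :=
      measurable_unitDir.comp measurable_fst
    fun_prop
  calc _ ≤ ∫⁻ y, ENNReal.ofReal (‖y.1‖ ^ 2 / ((M : ℝ) - 1)) *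
        ENNReal.ofReal (1 - ‖inner ℂ (unitDir y.1) (quantize y.1 y.2)‖ ^ 2) ∂userLaw M N := by
        apply lintegral_mono_ae
        filter_upwards [userLaw_ae_norm_quantize hM0 hN, hne] with y hy hy0
        refine (leakage_le hM hij hy y.1).trans_eq ?_
        rw [← ENNReal.ofReal_mul (by positivity)]
        congr 1
        have : ‖y.1‖ ≠ 0 := norm_ne_zero_iff.2 hy0
        rw [unitDir, inner_smul_left, norm_mul, norm_inner_symm, RCLike.norm_conj,
          Complex.norm_real, norm_inv, norm_norm]
        field_simp
    _ = ∫⁻ h, ∫⁻ w, ENNReal.ofReal (‖h‖ ^ 2 / ((M : ℝ) - 1)) *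
        ENNReal.ofReal (1 - ‖inner ℂ (unitDir h) (quantize h w)‖ ^ 2)
        ∂Measure.pi (fun _ => isotropic M) ∂gaussianVector M := by
        rw [userLaw, lintegral_prod]
        exact (Measurable.mul (by fun_prop) hme).aemeasurable
    _ ≤ ∫⁻ h, ENNReal.ofReal (‖h‖ ^ 2 / ((M : ℝ) - 1)) * ENNReal.ofReal A ∂gaussianVector M := by
        apply lintegral_mono_ae
        filter_upwards [gaussianVector_ae_ne_zero hM0] with h hh
        have hq := measurable_quantize_right (N := N) h
        rw [lintegral_const_mul _ (by fun_prop)]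
        gcongr
        exact lintegral_quantize_error_le hM0 hN hh
    _ = ENNReal.ofReal (M / ((M : ℝ) - 1) * A) := by
        rw [lintegral_mul_const _ (by fun_prop), ← ofReal_integral_eq_lintegral_ofReal
          ((integrable_normSq_gaussianVector M).div_const _) (ae_of_all _ fun h => by positivity),
          integral_div, integral_normSq_gaussianVector, ENNReal.ofReal_mul (by positivity)]

end

/-! ### Jensen's inequality and high-SNR limits of logarithmic means. -/

section Log

variable {α : Type*} [MeasurableSpace α] {μ : Measure α}

theorem logb_one_add_nonneg {x : ℝ} (hx : 0 ≤ x) : 0 ≤ Real.logb 2 (1 + x) :=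
  Real.logb_nonneg one_lt_two (by linarith)

/-- The tangent of the concave logarithm at `m`: it yields integrability for m = 0 and Jensen for
`m` the mean. -/
theorem logb_one_add_le {x m : ℝ} (hx : 0 ≤ x) (hm : 0 ≤ m) :
    Real.logb 2 (1 + x) ≤ Real.logb 2 (1 + m) + (x - m) / ((1 + m) * Real.log 2) := by
  have h2 : 0 < Real.log 2 := Real.log_pos one_lt_two
  have hm1 : 0 < 1 + m := by linarith
  have h := Real.log_le_sub_one_of_pos (x := (1 + x) / (1 + m)) (by positivity)
  rw [Real.log_div (by positivity) (by positivity)] at h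
  have e : (x - m) / ((1 + m) * Real.log 2) = ((1 + x) / (1 + m) - 1) / Real.log 2 := by
    field_simp; ring
  rw [e, Real.logb, Real.logb, ← add_div]
  gcongr
  linarith

theorem integrable_logb_one_add {X : α → ℝ} (hX : Integrable X μ) (h0 : ∀ a, 0 ≤ X a) :
    Integrable (fun a => Real.logb 2 (1 + X a)) μ := by
  refine (hX.div_const (Real.log 2)).mono' ?_ (ae_of_all _ fun a => ?_)
  · have := hX.aestronglyMeasurable.aemeasurable
    unfold Real.logb
    exact ((Real.measurable_log.comp_aemeasurable
      (this.const_add 1)).div_const _).aestronglyMeasurable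
  · rw [Real.norm_of_nonneg (logb_one_add_nonneg (h0 a))]
    simpa using logb_one_add_le (h0 a) le_rfl

theorem integral_logb_one_add_le [IsProbabilityMeasure μ] {X : α → ℝ} (hX : Integrable X μ)
    (h0 : ∀ a, 0 ≤ X a) :
    ∫ a, Real.logb 2 (1 + X a) ∂μ ≤ Real.logb 2 (1 + ∫ a, X a ∂μ) := by
  have hm : 0 ≤ ∫ a, X a ∂μ := integral_nonneg h0
  set m := ∫ a, X a ∂μ with hmdef
  have hi : Integrable (fun a => (X a - m) / ((1 + m) * Real.log 2)) μ :=
    (hX.sub (integrable_const m)).div_const _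
  refine (integral_mono (integrable_logb_one_add hX h0) ((integrable_const _).add hi)
    fun a => logb_one_add_le (h0 a) hm).trans_eq ?_
  simp only [Pi.add_apply]
  rw [integral_add (integrable_const _) hi, integral_div, integral_sub hX (integrable_const m)]
  simp [← hmdef]

theorem tendsto_inv_add_const {c : ℝ} : Tendsto (fun P : ℝ => P⁻¹ + c) atTop (𝓝 c) := by
  simpa using tendsto_inv_atTop_zero.add_const c

theorem tendsto_logb_two : Tendsto (fun P : ℝ => Real.logb 2 P) atTop atTop :=
  Real.tendsto_logb_atTop one_lt_two

/-- Dominated convergence: for P ≥ 2 one has 1 + P X ≤ P (1 + X) and log₂ P ≥ 1, which gives the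
integrable bound 1 + log₂(1 + X). -/
theorem tendsto_integral_logb_div [IsProbabilityMeasure μ] {X : α → ℝ} (hX : Integrable X μ)
    (h0 : ∀ a, 0 ≤ X a) (hpos : ∀ᵐ a ∂μ, 0 < X a) :
    Tendsto (fun P : ℝ => (∫ a, Real.logb 2 (1 + P * X a) ∂μ) / Real.logb 2 P) atTop (𝓝 1) := by
  have h1 : (1 : ℝ) = ∫ _ : α, (1 : ℝ) ∂μ := by simp
  simp_rw [← integral_div]
  conv => enter [3]; rw [h1]
  apply tendsto_integral_filter_of_dominated_convergence (fun a => 1 + Real.logb 2 (1 + X a))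
  · filter_upwards [eventually_ge_atTop 0] with P hP
    exact ((integrable_logb_one_add (hX.const_mul P)
      fun a => mul_nonneg hP (h0 a)).div_const _).aestronglyMeasurable
  · filter_upwards [eventually_ge_atTop 2] with P hP
    refine ae_of_all _ fun a => ?_
    have hl : 1 ≤ Real.logb 2 P := by
      rw [Real.le_logb_iff_rpow_le one_lt_two (by linarith)]; simpa using hP
    have hPX : 0 ≤ P * X a := mul_nonneg (by linarith) (h0 a)
    have hXn := logb_one_add_nonneg (h0 a)
    rw [Real.norm_of_nonneg (div_nonneg (logb_one_add_nonneg hPX) (by linarith)),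
      div_le_iff₀ (by linarith)]
    have h2 : Real.logb 2 (1 + P * X a) ≤ Real.logb 2 (P * (1 + X a)) :=
      Real.logb_le_logb_of_le one_lt_two (by positivity) (by linarith)
    rw [Real.logb_mul (by linarith) (by linarith [h0 a])] at h2
    nlinarith
  · exact (integrable_const _).add (integrable_logb_one_add hX h0)
  · filter_upwards [hpos] with a ha
    have h2 : Tendsto (fun P : ℝ => 1 + Real.logb 2 (P⁻¹ + X a) / Real.logb 2 P) atTop (𝓝 1) := by
      have : Tendsto (fun P : ℝ => Real.logb 2 (P⁻¹ + X a)) atTop (𝓝 (Real.logb 2 (X a))) :=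
        ((Real.continuousAt_logb ha.ne').tendsto).comp tendsto_inv_add_const
      simpa using (this.div_atTop tendsto_logb_two).const_add 1
    refine h2.congr' ?_
    filter_upwards [eventually_ge_atTop 2] with P hP
    have hP0 : (0:ℝ) < P := by linarith
    have hl : Real.logb 2 P ≠ 0 := by
      have := Real.logb_pos one_lt_two (by linarith : 1 < P); exact this.ne'
    have e : 1 + P * X a = P * (P⁻¹ + X a) := by field_simp
    rw [e, Real.logb_mul hP0.ne' (by positivity)]
    field_simp

/-- The difference of the integrands stays between 0 and log₂ b, so a constant dominates. No
integrability of log X is needed. -/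
theorem tendsto_integral_logb_sub [IsProbabilityMeasure μ] {X : α → ℝ} (hX : Integrable X μ)
    (h0 : ∀ a, 0 ≤ X a) (hpos : ∀ᵐ a ∂μ, 0 < X a) {b : ℝ} (hb : 1 < b) :
    Tendsto (fun P : ℝ => (∫ a, Real.logb 2 (1 + P * X a) ∂μ) -
      ∫ a, Real.logb 2 (1 + P / b * X a) ∂μ) atTop (𝓝 (Real.logb 2 b)) := by
  have hb0 : 0 < b := by linarith
  have hint : ∀ P : ℝ, 0 ≤ P → Integrable (fun a => Real.logb 2 (1 + P * X a)) μ := fun P hP =>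
    integrable_logb_one_add (hX.const_mul P) fun a => mul_nonneg hP (h0 a)
  have h1 : Real.logb 2 b = ∫ _ : α, Real.logb 2 b ∂μ := by simp
  rw [h1]
  have key : Tendsto (fun P : ℝ => ∫ a, (Real.logb 2 (1 + P * X a) -
      Real.logb 2 (1 + P / b * X a)) ∂μ) atTop (𝓝 (∫ _ : α, Real.logb 2 b ∂μ)) := by
    apply tendsto_integral_filter_of_dominated_convergence (fun a => Real.logb 2 b)
    · filter_upwards [eventually_ge_atTop 0] with P hP
      exact ((hint P hP).sub (hint (P / b) (by positivity))).aestronglyMeasurable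
    · filter_upwards [eventually_ge_atTop 0] with P hP
      refine ae_of_all _ fun a => ?_
      have hXa := h0 a
      have h3 : 0 ≤ P / b * X a := by positivity
      have h4 : P / b * X a ≤ P * X a := by
        gcongr
        exact div_le_self hP hb.le
      rw [Real.norm_of_nonneg (sub_nonneg.2
        (Real.logb_le_logb_of_le one_lt_two (by linarith) (by linarith))), sub_le_iff_le_add,
        ← Real.logb_mul hb0.ne' (by linarith)]
      apply Real.logb_le_logb_of_le one_lt_two (by linarith)
      have : b * (1 + P / b * X a) = b + P * X a := by field_simp
      linarith
    · exact integrable_const _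
    · filter_upwards [hpos] with a ha
      have h2 : Tendsto (fun P : ℝ => Real.logb 2 (P⁻¹ + X a) - Real.logb 2 (P⁻¹ + X a / b)) atTop
          (𝓝 (Real.logb 2 (X a) - Real.logb 2 (X a / b))) :=
        (((Real.continuousAt_logb ha.ne').tendsto).comp tendsto_inv_add_const).sub
          (((Real.continuousAt_logb (by positivity)).tendsto).comp tendsto_inv_add_const)
      have e : Real.logb 2 (X a) - Real.logb 2 (X a / b) = Real.logb 2 b := by
        rw [Real.logb_div ha.ne' hb0.ne']; ring
      rw [e] at h2
      refine h2.congr' ?_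
      filter_upwards [eventually_gt_atTop 0] with P hP
      have e1 : 1 + P * X a = P * (P⁻¹ + X a) := by field_simp
      have e2 : 1 + P / b * X a = P * (P⁻¹ + X a / b) := by field_simp
      rw [e1, e2, Real.logb_mul hP.ne' (by positivity), Real.logb_mul hP.ne' (by positivity)]
      ring
  refine key.congr' ?_
  filter_upwards [eventually_ge_atTop 0] with P hP
  rw [integral_sub (hint P hP) (hint (P / b) (by positivity))]

end Log

/-! ### From gains to rates. -/

/-- The gain of the beam of user `j` at user `i` with quantized channel knowledge. -/
def gain {M N : ℕ} (i j : Fin M) (ω : (Fin M → CVec M) × (Fin M → Fin N → CVec M)) : ℝ :=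
  ‖inner ℂ (ω.1 i) (zfBeam (quantizedChannels ω) j)‖ ^ 2

/-- The beam gain of user `i` with perfect channel knowledge. -/
def zfGain {M : ℕ} (i : Fin M) (h : Fin M → CVec M) : ℝ := ‖inner ℂ (h i) (zfBeam h i)‖ ^ 2

theorem gain_nonneg {M N : ℕ} (i j : Fin M) (ω : (Fin M → CVec M) × (Fin M → Fin N → CVec M)) :
    0 ≤ gain i j ω := sq_nonneg _

theorem zfGain_nonneg {M : ℕ} (i : Fin M) (h : Fin M → CVec M) : 0 ≤ zfGain i h := sq_nonneg _

theorem sq_norm_inner_zfBeam_le {M : ℕ} (x : CVec M) (g : Fin M → CVec M) (j : Fin M) :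
    ‖inner ℂ x (zfBeam g j)‖ ^ 2 ≤ ‖x‖ ^ 2 := by
  gcongr
  refine (norm_inner_le_norm x _).trans ?_
  exact mul_le_of_le_one_right (norm_nonneg _) (norm_zfBeam_le g j)

theorem integrable_normSq_channelLaw {M : ℕ} (i : Fin M) :
    Integrable (fun h => ‖h i‖ ^ 2) (channelLaw M) :=
  integrable_comp_eval (μ := fun _ : Fin M => gaussianVector M) (i := i)
    (f := fun x : CVec M => ‖x‖ ^ 2) (integrable_normSq_gaussianVector M)

theorem integrable_zfGain {M : ℕ} (i : Fin M) : Integrable (zfGain i) (channelLaw M) := by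
  refine (integrable_normSq_channelLaw i).mono' ?_ (ae_of_all _ fun h => ?_)
  · exact ((measurable_norm_inner_zfBeam i i measurable_id
      measurable_id).pow_const 2).aestronglyMeasurable
  · rw [Real.norm_of_nonneg (zfGain_nonneg i h)]
    exact sq_norm_inner_zfBeam_le _ _ _

theorem integrable_gain {M N : ℕ} (i j : Fin M) : Integrable (gain i j) (systemLaw M N) := by
  have : Integrable (fun ω : (Fin M → CVec M) × (Fin M → Fin N → CVec M) => ‖ω.1 i‖ ^ 2)
      (systemLaw M N) := (integrable_normSq_channelLaw i).comp_fst _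
  refine this.mono' ?_ (ae_of_all _ fun h => ?_)
  · exact ((measurable_norm_inner_zfBeam i j measurable_fst
      measurable_quantizedChannels).pow_const 2).aestronglyMeasurable
  · rw [Real.norm_of_nonneg (gain_nonneg i j h)]
    exact sq_norm_inner_zfBeam_le _ _ _

theorem zfGain_ae_pos {M : ℕ} (i : Fin M) : ∀ᵐ h ∂channelLaw M, 0 < zfGain i h := by
  filter_upwards [channelLaw_ae_det M] with h hh
  have := norm_pos_iff.2 (inner_zfBeam_self_ne_zero hh i)
  unfold zfGain
  positivity

theorem integral_gain_le {M N : ℕ} (hM : 2 ≤ M) (hN : 0 < N) {i j : Fin M} (hij : j ≠ i) :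
    ∫ ω, gain i j ω ∂systemLaw M N ≤
      M / ((M : ℝ) - 1) * ∫ z in (0:ℝ)..1, (1 - z ^ (M - 1)) ^ N := by
  have hM1 : (0 : ℝ) < (M : ℝ) - 1 := by
    have : (2 : ℝ) ≤ M := by exact_mod_cast hM
    linarith
  rw [integral_eq_lintegral_of_nonneg_ae (ae_of_all _ (gain_nonneg i j))
    (integrable_gain i j).aestronglyMeasurable]
  refine ENNReal.toReal_le_of_le_ofReal (mul_nonneg (by positivity) ?_)
    (lintegral_interference_le hM hN hij)
  refine intervalIntegral.integral_nonneg zero_le_one fun z hz => ?_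
  have := pow_le_one₀ (n := M - 1) hz.1 hz.2
  exact pow_nonneg (by linarith) _

theorem zfUserRate_eq {M : ℕ} (P : ℝ) (i : Fin M) :
    zfUserRate M P i = ∫ h, Real.logb 2 (1 + P / M * zfGain i h) ∂channelLaw M := rfl

/-- This puts both rates on the same probability space, so that they can be compared pointwise. -/
theorem zfUserRate_eq_gain {M N : ℕ} (hM : 0 < M) (hN : 0 < N) (P : ℝ) (i : Fin M) :
    zfUserRate M P i = ∫ ω, Real.logb 2 (1 + P / M * gain i i ω) ∂systemLaw M N := by
  have hφ : Measurable fun x : ℝ => Real.logb 2 (1 + P / M * x ^ 2) := by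
    unfold Real.logb; fun_prop
  have h1 := integral_map (μ := systemLaw M N) (measurable_norm_inner_zfBeam i i measurable_fst
    measurable_quantizedChannels).aemeasurable hφ.aestronglyMeasurable
  have h2 := integral_map (μ := channelLaw M) (measurable_norm_inner_zfBeam i i measurable_id
    measurable_id).aemeasurable hφ.aestronglyMeasurable
  simp only [id] at h2
  rw [map_signal hM hN i, h2] at h1
  exact h1

/-- The total interference power at user `i`. -/
def interference {M N : ℕ} (P : ℝ) (i : Fin M)
    (ω : (Fin M → CVec M) × (Fin M → Fin N → CVec M)) : ℝ :=
  ∑ j ∈ Finset.univ.erase i, P / M * gain i j ω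

theorem interference_nonneg {M N : ℕ} {P : ℝ} (hP : 0 ≤ P) (i : Fin M)
    (ω : (Fin M → CVec M) × (Fin M → Fin N → CVec M)) : 0 ≤ interference P i ω :=
  Finset.sum_nonneg fun j _ => mul_nonneg (by positivity) (gain_nonneg i j ω)

theorem integrable_interference {M N : ℕ} (P : ℝ) (i : Fin M) :
    Integrable (interference P i) (systemLaw M N) :=
  integrable_finsetSum _ fun j _ => (integrable_gain i j).const_mul _

/-- The M − 1 interferers, the power P/M per stream and the factor M/(M − 1) multiply to exactly P.
-/
theorem integral_interference_le {M N : ℕ} (hM : 2 ≤ M) (hN : 0 < N) {P : ℝ} (hP : 0 ≤ P)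
    (i : Fin M) :
    ∫ ω, interference P i ω ∂systemLaw M N ≤ P * ∫ z in (0:ℝ)..1, (1 - z ^ (M - 1)) ^ N := by
  have hM1 : (0 : ℝ) < (M : ℝ) - 1 := by
    have : (2 : ℝ) ≤ M := by exact_mod_cast hM
    linarith
  have hM0 : (0 : ℝ) < M := by linarith
  unfold interference
  rw [integral_finsetSum _ fun j _ => (integrable_gain i j).const_mul _]
  simp_rw [integral_const_mul]
  refine (Finset.sum_le_sum fun j hj => mul_le_mul_of_nonneg_left
    (integral_gain_le hM hN (Finset.ne_of_mem_erase hj)) (by positivity)).trans_eq ?_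
  rw [Finset.sum_const, Finset.card_erase_of_mem (Finset.mem_univ i), Finset.card_univ,
    Fintype.card_fin, nsmul_eq_mul, Nat.cast_sub (by omega)]
  push_cast
  field_simp

theorem fbInstRate_eq {M N : ℕ} {P : ℝ} (hP : 0 ≤ P) (i : Fin M)
    (ω : (Fin M → CVec M) × (Fin M → Fin N → CVec M)) :
    fbInstRate P i ω = Real.logb 2 (1 + (interference P i ω + P / M * gain i i ω)) -
      Real.logb 2 (1 + interference P i ω) := by
  have h1 := interference_nonneg hP i ω
  have h2 : 0 ≤ P / M * gain i i ω := mul_nonneg (by positivity) (gain_nonneg i i ω)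
  rw [← Real.logb_div (by positivity) (by positivity)]
  have : fbInstRate P i ω = Real.logb 2 (1 + P / M * gain i i ω / (1 + interference P i ω)) := rfl
  rw [this]
  congr 1
  field_simp
  ring

theorem integrable_fbInstRate {M N : ℕ} {P : ℝ} (hP : 0 ≤ P) (i : Fin M) :
    Integrable (fbInstRate P i) (systemLaw M N) := by
  have : (fbInstRate P i : (Fin M → CVec M) × (Fin M → Fin N → CVec M) → ℝ) = fun ω =>
      Real.logb 2 (1 + (interference P i ω + P / M * gain i i ω)) -
      Real.logb 2 (1 + interference P i ω) := funext fun ω => fbInstRate_eq hP i ω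
  rw [this]
  exact (integrable_logb_one_add ((integrable_interference P i).add
    ((integrable_gain i i).const_mul _)) fun ω => add_nonneg (interference_nonneg hP i ω)
      (mul_nonneg (by positivity) (gain_nonneg i i ω))).sub
    (integrable_logb_one_add (integrable_interference P i) (interference_nonneg hP i))

theorem integrable_zfInstRate {M : ℕ} {P : ℝ} (hP : 0 ≤ P) (i : Fin M) :
    Integrable (zfInstRate P i) (channelLaw M) :=
  integrable_logb_one_add ((integrable_zfGain i).const_mul _)
    fun h => mul_nonneg (by positivity) (zfGain_nonneg i h)

theorem integrable_logb_gain {M N : ℕ} {P : ℝ} (hP : 0 ≤ P) (i : Fin M) :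
    Integrable (fun ω => Real.logb 2 (1 + P / M * gain i i ω)) (systemLaw M N) :=
  integrable_logb_one_add ((integrable_gain i i).const_mul _)
    fun h => mul_nonneg (by positivity) (gain_nonneg i i h)

theorem fbUserRate_le {M N : ℕ} (hM : 0 < M) (hN : 0 < N) {P : ℝ} (hP : 0 ≤ P) (i : Fin M) :
    fbUserRate M N P i ≤ zfUserRate M P i := by
  rw [zfUserRate_eq_gain hM hN]
  refine integral_mono (integrable_fbInstRate hP i) (integrable_logb_gain hP i) fun ω => ?_
  have h1 := interference_nonneg hP i ω
  have h2 : 0 ≤ P / M * gain i i ω := mul_nonneg (by positivity) (gain_nonneg i i ω)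
  have : fbInstRate P i ω = Real.logb 2 (1 + P / M * gain i i ω / (1 + interference P i ω)) := rfl
  simp only [this]
  apply Real.logb_le_logb_of_le one_lt_two (by positivity)
  gcongr
  exact div_le_self h2 (by linarith)

/-- Pointwise the gap is at most log₂(1 + I), since adding I to the signal only raises the first
logarithm; Jensen does the rest. -/
theorem zfUserRate_sub_fbUserRate_le {M N : ℕ} (hM : 2 ≤ M) (hN : 0 < N) {P : ℝ} (hP : 0 ≤ P)
    (i : Fin M) :
    zfUserRate M P i - fbUserRate M N P i ≤
      Real.logb 2 (1 + P * ∫ z in (0:ℝ)..1, (1 - z ^ (M - 1)) ^ N) := by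
  have hI := integrable_interference (N := N) P i
  have hI0 := interference_nonneg (N := N) hP i
  rw [zfUserRate_eq_gain (N := N) (by omega) hN, fbUserRate,
    ← integral_sub (integrable_logb_gain hP i) (integrable_fbInstRate hP i)]
  calc _ ≤ ∫ ω, Real.logb 2 (1 + interference P i ω) ∂systemLaw M N := by
        refine integral_mono ((integrable_logb_gain hP i).sub (integrable_fbInstRate hP i))
          (integrable_logb_one_add hI hI0) fun ω => ?_
        have h1 := hI0 ω
        have h2 : 0 ≤ P / M * gain i i ω := mul_nonneg (by positivity) (gain_nonneg i i ω)
        have h3 : Real.logb 2 (1 + P / M * gain i i ω) ≤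
            Real.logb 2 (1 + (interference P i ω + P / M * gain i i ω)) :=
          Real.logb_le_logb_of_le one_lt_two (by positivity) (by linarith)
        beta_reduce
        rw [fbInstRate_eq hP]
        linarith
    _ ≤ Real.logb 2 (1 + ∫ ω, interference P i ω ∂systemLaw M N) :=
        integral_logb_one_add_le hI hI0
    _ ≤ _ := by
        have := integral_nonneg (μ := systemLaw M N) (f := interference P i) hI0
        apply Real.logb_le_logb_of_le one_lt_two (by positivity)
        linarith [integral_interference_le hM hN hP i]

/-- The prescription on `B` says N^(1/(M−1)) ≥ P/(b − 1). Strictness comes from replacing N + 1 by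
N. -/
theorem mul_integral_lt {M N : ℕ} (hM : 2 ≤ M) {b P B : ℝ} (hb : 1 < b) (hP : 0 < P)
    (hB : (N : ℝ) = (2 : ℝ) ^ B) (hbits : feedbackBits M b P ≤ B) :
    P * ∫ z in (0:ℝ)..1, (1 - z ^ (M - 1)) ^ N < b - 1 := by
  have hM1 : (0 : ℝ) < (M : ℝ) - 1 := by
    have : (2 : ℝ) ≤ M := by exact_mod_cast hM
    linarith
  have hb1 : 0 < b - 1 := by linarith
  have hN : (0 : ℝ) < N := by rw [hB]; positivity
  have hcast : ((M - 1 : ℕ) : ℝ) = (M : ℝ) - 1 := by rw [Nat.cast_sub (by omega)]; simp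
  have h1 := integral_one_sub_pow_le (m := M - 1) (by omega) N
  rw [hcast] at h1
  have h2 : ((N : ℝ) + 1) ^ (-(1 / ((M : ℝ) - 1))) < (N : ℝ) ^ (-(1 / ((M : ℝ) - 1))) :=
    Real.rpow_lt_rpow_of_neg hN (by linarith) (by rw [neg_lt_zero]; positivity)
  have h3 : P / (b - 1) ≤ (N : ℝ) ^ (1 / ((M : ℝ) - 1)) := by
    rw [hB, ← Real.rpow_mul zero_le_two, ← Real.logb_le_iff_le_rpow one_lt_two (by positivity),
      Real.logb_div hP.ne' hb1.ne', mul_one_div, le_div_iff₀ hM1]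
    unfold feedbackBits at hbits
    linarith
  have hq : 0 < (N : ℝ) ^ (1 / ((M : ℝ) - 1)) := by positivity
  calc _ < P * (N : ℝ) ^ (-(1 / ((M : ℝ) - 1))) := by
        exact mul_lt_mul_of_pos_left (h1.trans_lt h2) hP
    _ ≤ b - 1 := by
        rw [Real.rpow_neg hN.le, ← div_eq_mul_inv, div_le_iff₀ hq]
        rw [div_le_iff₀ hb1] at h3
        linarith

theorem zfUserRate_sub_fbUserRate_lt {M N : ℕ} (hM : 2 ≤ M) {b P B : ℝ} (hb : 1 < b) (hP : 0 < P)
    (hB : (N : ℝ) = (2 : ℝ) ^ B) (hbits : feedbackBits M b P ≤ B) (i : Fin M) :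
    zfUserRate M P i - fbUserRate M N P i < Real.logb 2 b := by
  have hN : 0 < N := by
    have : (0 : ℝ) < N := by rw [hB]; positivity
    exact_mod_cast this
  refine (zfUserRate_sub_fbUserRate_le hM hN hP.le i).trans_lt ?_
  have h := mul_integral_lt hM hb hP hB hbits
  have h0 : 0 ≤ ∫ z in (0:ℝ)..1, (1 - z ^ (M - 1)) ^ N := by
    refine intervalIntegral.integral_nonneg zero_le_one fun z hz => ?_
    have := pow_le_one₀ (n := M - 1) hz.1 hz.2
    exact pow_nonneg (by linarith) _
  exact Real.logb_lt_logb one_lt_two (by positivity) (by linarith)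

theorem zfThroughput_sub_fbThroughput_lt {M N : ℕ} (hM : 2 ≤ M) {b P B : ℝ} (hb : 1 < b)
    (hP : 0 < P) (hB : (N : ℝ) = (2 : ℝ) ^ B) (hbits : feedbackBits M b P ≤ B) :
    zfThroughput M P - fbThroughput M N P < M * Real.logb 2 b := by
  have : NeZero M := ⟨by omega⟩
  rw [zfThroughput, fbThroughput, ← Finset.sum_sub_distrib]
  calc _ < ∑ _ : Fin M, Real.logb 2 b := Finset.sum_lt_sum_of_nonempty Finset.univ_nonempty
        fun i _ => zfUserRate_sub_fbUserRate_lt hM hb hP hB hbits i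
    _ = _ := by simp

theorem fbThroughput_le {M N : ℕ} (hM : 0 < M) (hN : 0 < N) {P : ℝ} (hP : 0 ≤ P) :
    fbThroughput M N P ≤ zfThroughput M P :=
  Finset.sum_le_sum fun i _ => fbUserRate_le hM hN hP i

theorem tendsto_zfThroughput_div (M : ℕ) (hM : 0 < M) :
    Tendsto (fun P => zfThroughput M P / Real.logb 2 P) atTop (𝓝 M) := by
  have hM' : (0 : ℝ) < M := by exact_mod_cast hM
  have h : ∀ i : Fin M, Tendsto (fun P => zfUserRate M P i / Real.logb 2 P) atTop (𝓝 1) := by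
    intro i
    have := tendsto_integral_logb_div ((integrable_zfGain i).div_const M)
      (fun h => div_nonneg (zfGain_nonneg i h) hM'.le)
      ((zfGain_ae_pos i).mono fun h hh => div_pos hh hM')
    refine this.congr fun P => ?_
    rw [zfUserRate_eq]
    simp_rw [div_mul_eq_mul_div, mul_div_assoc]
  have := tendsto_finsetSum Finset.univ fun i _ => h i
  simp only [Finset.sum_const, Finset.card_univ, Fintype.card_fin, nsmul_eq_mul, mul_one] at this
  refine this.congr fun P => ?_
  rw [zfThroughput, Finset.sum_div]

theorem tendsto_zfThroughput_sub (M : ℕ) (hM : 0 < M) {b : ℝ} (hb : 1 < b) :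
    Tendsto (fun P => zfThroughput M P - zfThroughput M (P / b)) atTop
      (𝓝 (M * Real.logb 2 b)) := by
  have hM' : (0 : ℝ) < M := by exact_mod_cast hM
  have h : ∀ i : Fin M, Tendsto (fun P => zfUserRate M P i - zfUserRate M (P / b) i) atTop
      (𝓝 (Real.logb 2 b)) := by
    intro i
    have := tendsto_integral_logb_sub ((integrable_zfGain i).div_const M)
      (fun h => div_nonneg (zfGain_nonneg i h) hM'.le)
      ((zfGain_ae_pos i).mono fun h hh => div_pos hh hM') hb
    refine this.congr fun P => ?_
    rw [zfUserRate_eq, zfUserRate_eq]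
    simp_rw [div_mul_eq_mul_div _ (M : ℝ), mul_div_assoc]
  have := tendsto_finsetSum Finset.univ fun i _ => h i
  simp only [Finset.sum_const, Finset.card_univ, Fintype.card_fin, nsmul_eq_mul] at this
  refine this.congr fun P => ?_
  rw [zfThroughput, zfThroughput, Finset.sum_sub_distrib]

/-! ### Numerical constants and decibels. -/

theorem abs_decibel_two_sub_three_lt : |decibel 2 - 3| < 1 / 80 := by
  -- Equivalent to 10³ < 2¹⁰.
  have h1 : (3 / 10 : ℝ) < Real.logb 10 2 := by
    rw [Real.lt_logb_iff_rpow_lt (by norm_num) (by norm_num),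
      ← Real.rpow_lt_rpow_iff (z := 10) (by positivity) (by positivity) (by norm_num),
      ← Real.rpow_mul (by norm_num)]
    norm_num
  -- Equivalent to 2⁹³ < 10²⁸; the fraction 28/93 is close enough to log₁₀ 2 for the tolerances here
  -- and in the next lemma.
  have h2 : Real.logb 10 2 < 28 / 93 := by
    rw [Real.logb_lt_iff_lt_rpow (by norm_num) (by norm_num),
      ← Real.rpow_lt_rpow_iff (z := 93) (by positivity) (by positivity) (by norm_num),
      ← Real.rpow_mul (by norm_num)]
    norm_num
  rw [decibel, abs_lt]
  constructor <;> linarith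

theorem abs_logb_two_ten_div_sub_lt : |Real.logb 2 10 / 10 - 1 / 3| < 1 / 800 := by
  have h1 : (93 / 28 : ℝ) < Real.logb 2 10 := by
    rw [Real.lt_logb_iff_rpow_lt (by norm_num) (by norm_num),
      ← Real.rpow_lt_rpow_iff (z := 28) (by positivity) (by positivity) (by norm_num),
      ← Real.rpow_mul (by norm_num)]
    norm_num
  have h2 : Real.logb 2 10 < 10 / 3 := by
    rw [Real.logb_lt_iff_lt_rpow (by norm_num) (by norm_num),
      ← Real.rpow_lt_rpow_iff (z := 3) (by positivity) (by positivity) (by norm_num),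
      ← Real.rpow_mul (by norm_num)]
    norm_num
  rw [abs_lt]
  constructor <;> linarith

theorem feedbackBits_eq_decibel (M : ℕ) (b P : ℝ) : feedbackBits M b P =
    ((M : ℝ) - 1) * (Real.logb 2 10 / 10) * decibel P - ((M : ℝ) - 1) * Real.logb 2 (b - 1) := by
  have : Real.logb 2 10 * Real.logb 10 P = Real.logb 2 P :=
    Real.mul_logb (by norm_num) (by norm_num) (by norm_num)
  rw [feedbackBits, decibel, ← this]
  ring

/-! ### High-SNR consequences of the bounded gap. -/

section Scaling

variable {M : ℕ} {b : ℝ} {B : ℝ → ℝ} {N : ℝ → ℕ}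

theorem eventually_gap (hM : 2 ≤ M) (hb : 1 < b)
    (hBN : ∀ᶠ P in atTop, (N P : ℝ) = (2 : ℝ) ^ B P ∧ feedbackBits M b P ≤ B P) :
    ∀ᶠ P in atTop, fbThroughput M (N P) P ≤ zfThroughput M P ∧
      zfThroughput M P - M * Real.logb 2 b < fbThroughput M (N P) P := by
  filter_upwards [hBN, eventually_gt_atTop 0] with P hP hP0
  have hN : 0 < N P := by
    have : (0 : ℝ) < N P := by rw [hP.1]; positivity
    exact_mod_cast this
  refine ⟨fbThroughput_le (by omega) hN hP0.le, ?_⟩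
  linarith [zfThroughput_sub_fbThroughput_lt hM hb hP0 hP.1 hP.2]

theorem hasMultiplexingGain_fbThroughput (hM : 2 ≤ M) (hb : 1 < b)
    (hBN : ∀ᶠ P in atTop, (N P : ℝ) = (2 : ℝ) ^ B P ∧ feedbackBits M b P ≤ B P) :
    HasMultiplexingGain (fun P => fbThroughput M (N P) P) M := by
  have hz := tendsto_zfThroughput_div M (by omega)
  have hlow : Tendsto (fun P => zfThroughput M P / Real.logb 2 P -
      M * Real.logb 2 b / Real.logb 2 P) atTop (𝓝 M) := by
    simpa using hz.sub (tendsto_const_nhds.div_atTop tendsto_logb_two)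
  refine tendsto_of_tendsto_of_tendsto_of_le_of_le' hlow hz ?_ ?_
  · filter_upwards [eventually_gap hM hb hBN, eventually_gt_atTop 1] with P hP hP1
    have := Real.logb_pos one_lt_two hP1
    rw [← sub_div]
    gcongr
    exact hP.2.le
  · filter_upwards [eventually_gap hM hb hBN, eventually_gt_atTop 1] with P hP hP1
    have := Real.logb_pos one_lt_two hP1
    gcongr
    exact hP.1

/-- With c = 10^(δ/10) > b, perfect-CSIT zero-forcing gains nearly M log₂ c from `P` to `c P`. This
eventually exceeds M log₂ b, which is more than the feedback loss at power `c P`. -/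
theorem powerOffsetAtMost_fbThroughput (hM : 2 ≤ M) (hb : 1 < b)
    (hBN : ∀ᶠ P in atTop, (N P : ℝ) = (2 : ℝ) ^ B P ∧ feedbackBits M b P ≤ B P) :
    PowerOffsetAtMost (zfThroughput M) (fun P => fbThroughput M (N P) P) (decibel b) := by
  intro δ hδ
  set c : ℝ := (10 : ℝ) ^ (δ / 10)
  have hM' : (0 : ℝ) < M := by exact_mod_cast (by omega : 0 < M)
  have hbc : b < c := by
    rw [← Real.logb_lt_iff_lt_rpow (by norm_num) (by linarith)]
    unfold decibel at hδ
    linarith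
  have hc : 0 < c := by linarith
  have hlim : Tendsto (fun P : ℝ => c * P) atTop atTop := tendsto_id.const_mul_atTop hc
  have hlog : M * Real.logb 2 b < M * Real.logb 2 c :=
    mul_lt_mul_of_pos_left (Real.logb_lt_logb one_lt_two (by linarith) hbc) hM'
  have h1 := ((tendsto_zfThroughput_sub M (by omega) (hb.trans hbc)).comp hlim).eventually
    (lt_mem_nhds hlog)
  filter_upwards [h1, hlim.eventually (eventually_gap hM hb hBN)] with P hP hP'
  have e : c * P / c = P := by field_simp
  rw [Function.comp_apply, e] at hP
  linarith [hP'.2]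

end Scaling

end ZFFeedback
end

open ZFFeedback
theorem theorem3 (M : ℕ) (hM : 2 ≤ M) (b : ℝ) (hb : 1 < b) :
    -- the rates are finite and the gap is below `log₂ b` at every SNR
    (∀ P : ℝ, 0 < P → ∀ (B : ℝ) (N : ℕ), (N : ℝ) = (2 : ℝ) ^ B → feedbackBits M b P ≤ B →
      (∀ i : Fin M, Integrable (zfInstRate P i) (channelLaw M) ∧
        Integrable (fbInstRate P i) (systemLaw M N) ∧
        zfUserRate M P i - fbUserRate M N P i < Real.logb 2 b) ∧
      rateGap M N P < Real.logb 2 b) ∧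
    -- full multiplexing gain and high-SNR power offset
    (∀ (B : ℝ → ℝ) (N : ℝ → ℕ),
      (∀ᶠ P in atTop, (N P : ℝ) = (2 : ℝ) ^ B P ∧ feedbackBits M b P ≤ B P) →
      HasMultiplexingGain (fun P => fbThroughput M (N P) P) M ∧
      PowerOffsetAtMost (zfThroughput M) (fun P => fbThroughput M (N P) P) (decibel b)) ∧
    -- a throughput loss of `M log₂ b` is worth a power factor `b`, which is about 3 dB for `b = 2`
    Tendsto (fun P => zfThroughput M P - zfThroughput M (P / b)) atTop
      (𝓝 (M * Real.logb 2 b)) ∧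
    |decibel 2 - 3| < 1 / 80 ∧
    -- the number of bits in terms of the SNR in dB
    (∀ P : ℝ, 0 < P → feedbackBits M b P =
      ((M : ℝ) - 1) * (Real.logb 2 10 / 10) * decibel P - ((M : ℝ) - 1) * Real.logb 2 (b - 1)) ∧
    |Real.logb 2 10 / 10 - 1 / 3| < 1 / 800 := by
  refine ⟨fun P hP B N hBN hbits => ⟨fun i => ⟨integrable_zfInstRate hP.le i,
    integrable_fbInstRate hP.le i, zfUserRate_sub_fbUserRate_lt hM hb hP hBN hbits i⟩, ?_⟩,
    fun B N hBN => ⟨hasMultiplexingGain_fbThroughput hM hb hBN,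
      powerOffsetAtMost_fbThroughput hM hb hBN⟩,
    tendsto_zfThroughput_sub M (by omega) hb, abs_decibel_two_sub_three_lt,
    fun P _ => feedbackBits_eq_decibel M b P, abs_logb_two_ten_div_sub_lt⟩
  have hM' : (0 : ℝ) < M := by exact_mod_cast (by omega : 0 < M)
  rw [rateGap, one_div, ← div_eq_inv_mul, div_lt_iff₀ hM', mul_comm]
  exact zfThroughput_sub_fbThroughput_lt hM hb hP hBN hbits
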